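/- Theorem 2.3 (Zellner's Invariance Theorem). Let $G$ be a Lie group modelled on a real Hausdorff locally convex space, with Lie algebra $\mathfrak g$ and a smooth exponential map $x\mapsto e^x$, $\mathfrak g\to G$. (Smoothness is in the sense of continuous iterated directional derivatives.) Let $\gamma:\mathbb R\to\mathrm{Aut}(G)$ be a one-parameter group of smooth automorphisms of $G$ such that $(t,g)\mapsto\gamma_t(g)$ is continuous, and let $\alpha_t:=\mathbf L(\gamma_t)_{\mathbb C}$ be the complexification of the differential $\mathbf L(\gamma_t)$ of $\gamma_t$ at the identity, acting on $\mathfrak g_{\mathbb C}=\mathfrak g\oplus i\mathfrak g$. Let $\mathcal H$ be a complex Hilbert space and let $\pi^\#:G\rtimes_\gamma\mathbb R\to \mathrm U(\mathcal H)$, $\pi^\#(g,t)=\pi(g)U_t$, be a (strongly) continuous unitary representation. Let $\mathcal H^\infty$ be the space of those $v\in\mathcal H$ for which the orbit map $G\to\mathcal H$, $g\mapsto\pi(g)v$, is smooth. For $v\in\mathcal H^\infty$ and $x,y\in\mathfrak g$ put $\mathrm d\pi(x)v:=\frac{d}{dt}\big|_{t=0}\pi(e^{tx})v$ and $\mathrm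 d\pi(x+iy)v:=\mathrm d\pi(x)v+i\,\mathrm d\pi(y)v$. For $f\in L^1(\mathbb R)$ (complex-valued) put $U_fv:=\int_{\mathbb R}f(t)U_tv\,dt$. The family $\alpha$ is called equicontinuous if for every open $0$-neighborhood $O$ in $\mathfrak g_{\mathbb C}$ there is a $0$-neighborhood $W$ with $\alpha_t(W)\subseteq O$ for all $t\in\mathbb R$. It is called polynomially bounded if for every continuous seminorm $p$ on $\mathfrak g_{\mathbb C}$ there is $N\in\mathbb N_0$ such that $\{(1+|t|^N)^{-1}\alpha_t:t\in\mathbb R\}$ is equicontinuous as a set of maps from $\mathfrak g_{\mathbb C}$ to $\mathfrak g_{\mathbb C}$ with the topology of the single seminorm $p$. Assume that at least one of the following holds: (a) $\alpha$ is equicontinuous and $f\in L^1(\mathbb R)$; or (b) $\alpha$ is polynomially bounded and $f\in\mathcal S(\mathbb R)$, the Schwartz space. Then $U_f\mathcal H^\infty\subseteq\mathcal H^\infty$, and for all $n\in\mathbb N_0$, $y_1,\dots,y_n\in\mathfrak g_{\mathbb C}$ and $v\in\mathcal H^\infty$, the function $t\mapsto f(t)U_t\,\mathrm d\pi(\alpha_{-t}(y_1))\cdots\mathrm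 d\pi(\alpha_{-t}(y_n))v$ is integrable and $$\mathrm d\pi(y_1)\cdots\mathrm d\pi(y_n)U_fv=\int_{\mathbb R}f(t)\,U_t\,\mathrm d\pi(\alpha_{-t}(y_1))\cdots\mathrm d\pi(\alpha_{-t}(y_n))v\,dt .$$ -/

import Mathlib

open Filter Topology MeasureTheory
open scoped SchwartzMap

/-! ### Calculus in locally convex spaces

Throughout, locally convex spaces are real and Hausdorff.  Differential calculus is the usual
calculus of iterated directional derivatives (Michal--Bastiani, Keller `C^∞_c`). -/

section Calculus

variable {E F : Type*}
  [AddCommGroup E] [Module ℝ E] [TopologicalSpace E]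
  [AddCommGroup F] [Module ℝ F] [TopologicalSpace F]

/-- `f` has directional derivative `y` at `x` in the direction `h`:
`y = lim_{t → 0} t⁻¹ (f (x + t h) - f x)`. -/
def HasDirDeriv (f : E → F) (x h : E) (y : F) : Prop :=
  Tendsto (fun t : ℝ => t⁻¹ • (f (x + t • h) - f x)) (𝓝[≠] 0) (𝓝 y)

/-- The directional derivative `df(x)(h)` (meaningful when the limit exists). -/
noncomputable def dirDeriv (f : E → F) (x h : E) : F :=
  @limUnder _ _ _ ⟨0⟩ (𝓝[≠] (0 : ℝ)) (fun t : ℝ => t⁻¹ • (f (x + t • h) - f x))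

/-- `f` is smooth on the open set `U`: all iterated directional derivatives
`d^j f(x)(h₁, …, h_j)`, `x ∈ U`, exist, and every `d^j f : U × E^j → F` is continuous
(for `j = 0` this says that `f` itself is continuous on `U`).  The set `U` is always open below,
so only the values of `f` on `U` matter. -/
def SmoothOnLC (f : E → F) (U : Set E) : Prop :=
  ∃ D : (j : ℕ) → E → (Fin j → E) → F,
    (∀ x ∈ U, ∀ h : Fin 0 → E, D 0 x h = f x) ∧
    (∀ (j : ℕ), ∀ x ∈ U, ∀ h : Fin (j + 1) → E,
      HasDirDeriv (fun z => D j z (Fin.init h)) x (h (Fin.last j)) (D (j + 1) x h)) ∧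
    (∀ j : ℕ, ContinuousOn (fun p : E × (Fin j → E) => D j p.1 p.2) (U ×ˢ Set.univ))

end Calculus

/-! ### Manifolds and Lie groups modelled on locally convex spaces -/

section Manifold

/-- The changes of charts of the given `E`-atlas of `M` are smooth. -/
def IsLCManifold (E M : Type*) [AddCommGroup E] [Module ℝ E] [TopologicalSpace E]
    [TopologicalSpace M] [ChartedSpace E M] : Prop :=
  ∀ e ∈ atlas E M, ∀ e' ∈ atlas E M,
    SmoothOnLC (fun u => e' (e.symm u)) (e.target ∩ e.symm ⁻¹' e'.source)

/-- Smooth maps between manifolds modelled on `E` and `F`: continuous maps that are smooth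
in all pairs of charts. -/
def SmoothMapLC (E F : Type*) {M N : Type*}
    [AddCommGroup E] [Module ℝ E] [TopologicalSpace E]
    [AddCommGroup F] [Module ℝ F] [TopologicalSpace F]
    [TopologicalSpace M] [ChartedSpace E M] [TopologicalSpace N] [ChartedSpace F N]
    (f : M → N) : Prop :=
  Continuous f ∧ ∀ e ∈ atlas E M, ∀ e' ∈ atlas F N,
    SmoothOnLC (fun u => e' (f (e.symm u))) (e.target ∩ e.symm ⁻¹' (f ⁻¹' e'.source))

/-- `G` is a locally convex Lie group modelled on `E`: a manifold with smooth multiplication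
`G × G → G` (tested in product charts) and smooth inversion.
The Lie algebra `𝔤 = T₁ G` is identified with `E` by means of the preferred chart at `1`. -/
structure IsLCLieGroup (E G : Type*) [AddCommGroup E] [Module ℝ E] [TopologicalSpace E]
    [TopologicalSpace G] [ChartedSpace E G] [Group G] : Prop where
  manifold : IsLCManifold E G
  continuous_mul : Continuous (fun p : G × G => p.1 * p.2)
  smooth_mul : ∀ e₁ ∈ atlas E G, ∀ e₂ ∈ atlas E G, ∀ e₃ ∈ atlas E G,
    SmoothOnLC (fun u : E × E => e₃ (e₁.symm u.1 * e₂.symm u.2))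
      {u | u.1 ∈ e₁.target ∧ u.2 ∈ e₂.target ∧ e₁.symm u.1 * e₂.symm u.2 ∈ e₃.source}
  smooth_inv : SmoothMapLC E E (fun g : G => g⁻¹)

variable {E G : Type*} [AddCommGroup E] [Module ℝ E] [TopologicalSpace E]
  [TopologicalSpace G] [ChartedSpace E G] [Group G]

/-- `expG : 𝔤 → G` is a smooth exponential map: it is smooth, and for every `x ∈ 𝔤` the curve
`t ↦ expG (t x)` is a one-parameter group whose velocity at `t = 0` is `x`. -/
structure IsSmoothExp (expG : E → G) : Prop where
  smooth : SmoothMapLC E E expG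
  add_smul : ∀ (x : E) (s t : ℝ), expG ((s + t) • x) = expG (s • x) * expG (t • x)
  velocity : ∀ x : E,
    HasDirDeriv (fun s : ℝ => chartAt E (1 : G) (expG (s • x))) 0 1 x

/-- The differential `L(ψ) = T₁(ψ) : 𝔤 → 𝔤` of a smooth endomorphism `ψ` of `G`. -/
noncomputable def lieDifferential (ψ : G → G) (x : E) : E :=
  dirDeriv (fun u => chartAt E (1 : G) (ψ ((chartAt E (1 : G)).symm u))) (chartAt E (1 : G) 1) x

end Manifold

/-! ### The complexification of a real locally convex space -/

/-- The complexification `E_ℂ = E ⊕ iE`, with the product topology. -/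
@[ext] structure Complexified (E : Type*) where
  /-- The real part. -/
  re : E
  /-- The imaginary part. -/
  im : E

namespace Complexified

variable {E : Type*}

/-- `x + iy ↔ (x, y)`. -/
def equivProd (E : Type*) : Complexified E ≃ E × E where
  toFun z := (z.re, z.im)
  invFun p := ⟨p.1, p.2⟩
  left_inv _ := rfl
  right_inv _ := rfl

instance [TopologicalSpace E] : TopologicalSpace (Complexified E) :=
  TopologicalSpace.induced (equivProd E) inferInstance

instance [AddCommGroup E] : AddCommGroup (Complexified E) := (equivProd E).addCommGroup

/-- `(a + ib)(x + iy) = (ax - by) + i(ay + bx)`. -/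
instance [AddCommGroup E] [Module ℝ E] : SMul ℂ (Complexified E) :=
  ⟨fun c z => ⟨c.re • z.re - c.im • z.im, c.re • z.im + c.im • z.re⟩⟩

section
variable [AddCommGroup E]

@[simp] theorem re_add (z w : Complexified E) : (z + w).re = z.re + w.re := rfl
@[simp] theorem im_add (z w : Complexified E) : (z + w).im = z.im + w.im := rfl
@[simp] theorem re_zero : (0 : Complexified E).re = 0 := rfl
@[simp] theorem im_zero : (0 : Complexified E).im = 0 := rfl

variable [Module ℝ E]

@[simp] theorem re_smul (c : ℂ) (z : Complexified E) :
    (c • z).re = c.re • z.re - c.im • z.im := rfl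
@[simp] theorem im_smul (c : ℂ) (z : Complexified E) :
    (c • z).im = c.re • z.im + c.im • z.re := rfl

instance : Module ℂ (Complexified E) where
  one_smul z := by ext <;> simp
  mul_smul c d z := by
    ext <;> simp only [re_smul, im_smul, Complex.mul_re, Complex.mul_im] <;> module
  smul_zero c := by ext <;> simp
  zero_smul z := by ext <;> simp
  smul_add c z w := by ext <;> simp only [re_smul, im_smul, re_add, im_add] <;> module
  add_smul c d z := by
    ext <;> simp only [re_smul, im_smul, re_add, im_add, Complex.add_re, Complex.add_im] <;> module

end

/-- The complexification `T_ℂ (x + iy) = T x + i T y` of a map `T`. -/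
def map (T : E → E) (z : Complexified E) : Complexified E := ⟨T z.re, T z.im⟩

end Complexified

/-! ### Equicontinuity and polynomial boundedness -/

/-- Equicontinuity of a family of (linear) maps: for every open `0`-neighborhood `U` in `F` there
is a `0`-neighborhood `W` in `E` that every member of the family maps into `U`. -/
def EquicontFamily {ι E F : Type*} [Zero E] [TopologicalSpace E] [Zero F] [TopologicalSpace F]
    (T : ι → E → F) : Prop :=
  ∀ U : Set F, IsOpen U → (0 : F) ∈ U → ∃ W ∈ 𝓝 (0 : E), ∀ i, ∀ x ∈ W, T i x ∈ U

/-- Polynomial boundedness of `(α_t)_{t ∈ ℝ}`: for every continuous seminorm `p` on `V` there is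
`N ∈ ℕ₀` such that `(1 + |t|^N)⁻¹ α_t`, `t ∈ ℝ`, is an equicontinuous family of maps from `V` to
`(V, p)`.  The balls `{p < ε}` form a basis of `0`-neighborhoods of `(V, p)`. -/
def PolyBounded {V : Type*} [AddCommGroup V] [Module ℂ V] [TopologicalSpace V]
    (α : ℝ → V → V) : Prop :=
  ∀ p : Seminorm ℂ V, Continuous p → ∃ N : ℕ, ∀ ε : ℝ, 0 < ε → ∃ W ∈ 𝓝 (0 : V),
    ∀ t : ℝ, ∀ x ∈ W, p ((((1 + |t| ^ N)⁻¹ : ℝ) : ℂ) • α t x) < ε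

/-! ### Unitary representations -/

section Representation

variable {E G H : Type*} [AddCommGroup E] [Module ℝ E] [TopologicalSpace E]
  [TopologicalSpace G] [ChartedSpace E G] [Group G]
  [NormedAddCommGroup H] [InnerProductSpace ℂ H] [CompleteSpace H]

/-- The space `H^∞` of smooth vectors of `π`: those `v` whose orbit map `g ↦ π(g) v` is smooth. -/
def smoothVectors (E : Type*) {G H : Type*} [AddCommGroup E] [Module ℝ E] [TopologicalSpace E]
    [TopologicalSpace G] [ChartedSpace E G] [Group G]
    [NormedAddCommGroup H] [InnerProductSpace ℂ H] [CompleteSpace H]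
    (π : G →* unitary (H →L[ℂ] H)) : Set H :=
  {v | SmoothMapLC E H (fun g : G => (π g : H →L[ℂ] H) v)}

/-- The derived representation on smooth vectors, `dπ(x) v = d/dt|_{t=0} π(e^{tx}) v` for `x ∈ 𝔤`,
extended complex linearly to `𝔤_ℂ`: `dπ(x + iy) v = dπ(x) v + i dπ(y) v`. -/
noncomputable def derivedRep (expG : E → G) (π : G →* unitary (H →L[ℂ] H))
    (y : Complexified E) (v : H) : H :=
  deriv (fun t : ℝ => (π (expG (t • y.re)) : H →L[ℂ] H) v) 0 +
    Complex.I • deriv (fun t : ℝ => (π (expG (t • y.im)) : H →L[ℂ] H) v) 0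

/-- The iterated operator `dπ(y₁) ⋯ dπ(y_n) v`, for the list `[y₁, …, y_n]`. -/
noncomputable def derivedRepList (expG : E → G) (π : G →* unitary (H →L[ℂ] H))
    (ys : List (Complexified E)) (v : H) : H :=
  ys.foldr (fun y w => derivedRep expG π y w) v

/-- The integrated operator `U_f v = ∫ f(t) U_t v dt`, for `f ∈ L¹(ℝ)`. -/
noncomputable def integratedOp (U : ℝ → H →L[ℂ] H) (f : ℝ → ℂ) (v : H) : H :=
  ∫ t : ℝ, f t • U t v

end Representation

/-! The semidirect product law gives π(g)U_t = U_t π(γ_{-t}(g)). Hence every U_t preserves smooth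
vectors, and dπ(y₁)⋯dπ(y_k)U_t v = U_t dπ(α_{-t}y₁)⋯dπ(α_{-t}y_k)v. For fixed smooth v, the map
(y₁,…,y_k) ↦ dπ(y₁)⋯dπ(y_k)v is multilinear and continuous, so its norm is at most C∏p(y_i) for some
continuous seminorm p. Either hypothesis on (α, f) supplies a weight m and a continuous seminorm q
with p(α_{-t}y) ≤ m(t)q(y) and all |f|m^k integrable (`exists_weight_bound`). Since U_t is
isometric, dπ(y₁)⋯dπ(y_k)U_t v is bounded by C m(t)^k ∏q(y_i). This is the content of
`DominatedFamily`.

These bounds make I(y₁,…,y_k) = ∫ f(t) dπ(y₁)⋯dπ(y_k)U_t v dt a continuous multilinear map, with I()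
= U_f v. Differentiation under the integral sign along a curve in G gives dπ(y)I(ys) = I(y, ys), and
iterating this is the integral formula. For smoothness, the orbit map of I(ys) is differentiated in
a chart. At the point g with coordinates u, in direction h, the derivative is π(g)I(δ(u)h, ys),
where δ is the left logarithmic derivative of the inverse chart. This has the same shape with one
more argument, so induction on the order of differentiability applies
(`DominatedFamily.paramCk_integral`).

The calculus is carried by `ParamCk`, in which directions already used are kept as topological
parameters, so that C^{n+1} reduces to C^n of the first derivative. `ParamCk.linear_comp`
substitutes maps into linear slots without differentiating in the slot; it yields the chain rule,
the smoothness of dπ(y)w, and the induction above. -/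

set_option linter.unusedSectionVars false

/-! ### Directional derivatives -/

section DirDeriv

variable {D E F F' : Type*} [AddCommGroup D] [Module ℝ D] [AddCommGroup E] [Module ℝ E]
  [AddCommGroup F] [Module ℝ F] [TopologicalSpace F]
  [AddCommGroup F'] [Module ℝ F'] [TopologicalSpace F']

theorem HasDirDeriv.unique [T2Space F] {f : E → F} {x h : E} {y y' : F}
    (h₁ : HasDirDeriv f x h y) (h₂ : HasDirDeriv f x h y') : y = y' :=
  tendsto_nhds_unique h₁ h₂

theorem HasDirDeriv.dirDeriv_eq [T2Space F] {f : E → F} {x h : E} {y : F}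
    (h₁ : HasDirDeriv f x h y) : dirDeriv f x h = y :=
  Tendsto.limUnder_eq h₁

theorem HasDirDeriv.congr {f g : E → F} {x h : E} {y : F} (h₁ : HasDirDeriv f x h y)
    (hfg : ∀ᶠ t : ℝ in 𝓝 0, f (x + t • h) = g (x + t • h)) : HasDirDeriv g x h y := by
  have h0 : f x = g x := by simpa using hfg.self_of_nhds
  refine Tendsto.congr' ?_ h₁
  filter_upwards [nhdsWithin_le_nhds hfg] with t ht
  rw [ht, h0]

theorem dirDeriv_congr {f g : E → F} {x h : E}
    (hfg : ∀ᶠ t : ℝ in 𝓝 0, f (x + t • h) = g (x + t • h)) :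
    dirDeriv f x h = dirDeriv g x h := by
  have h0 : f x = g x := by simpa using hfg.self_of_nhds
  unfold dirDeriv limUnder
  congr 1
  refine Filter.map_congr ?_
  filter_upwards [nhdsWithin_le_nhds hfg] with t ht
  rw [ht, h0]

theorem hasDirDeriv_const (a : F) (x h : E) : HasDirDeriv (fun _ : E => a) x h 0 := by
  simpa [HasDirDeriv] using tendsto_const_nhds

theorem hasDirDeriv_id [TopologicalSpace E] (x h : E) : HasDirDeriv (fun z : E => z) x h h := by
  refine Tendsto.congr' ?_ tendsto_const_nhds
  filter_upwards [self_mem_nhdsWithin] with t ht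
  rw [add_sub_cancel_left, smul_smul, inv_mul_cancel₀ ht, one_smul]

theorem HasDirDeriv.add [IsTopologicalAddGroup F] {f g : E → F} {x h : E} {y z : F}
    (hf : HasDirDeriv f x h y) (hg : HasDirDeriv g x h z) :
    HasDirDeriv (fun u => f u + g u) x h (y + z) := by
  refine Tendsto.congr (fun t => ?_) (Tendsto.add hf hg)
  module

theorem HasDirDeriv.const_smul [ContinuousSMul ℝ F] {f : E → F} {x h : E} {y : F}
    (hf : HasDirDeriv f x h y) (c : ℝ) : HasDirDeriv (fun u => c • f u) x h (c • y) := by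
  refine Tendsto.congr (fun t => ?_) (Tendsto.const_smul hf c)
  module

theorem HasDirDeriv.clm_comp (L : F →L[ℝ] F') {f : E → F} {x h : E} {y : F}
    (hf : HasDirDeriv f x h y) : HasDirDeriv (fun u => L (f u)) x h (L y) := by
  refine Tendsto.congr (fun t => ?_) ((L.continuous.tendsto y).comp hf)
  simp

theorem HasDirDeriv.prodMk {f : E → F} {g : E → F'} {x h : E} {y : F} {z : F'}
    (hf : HasDirDeriv f x h y) (hg : HasDirDeriv g x h z) :
    HasDirDeriv (fun u => (f u, g u)) x h (y, z) :=
  Tendsto.prodMk_nhds hf hg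

theorem HasDirDeriv.smul_direction [ContinuousSMul ℝ F] {f : E → F} {x h : E} {y : F}
    (hf : HasDirDeriv f x h y) (c : ℝ) : HasDirDeriv f x (c • h) (c • y) := by
  rcases eq_or_ne c 0 with rfl | hc
  · simpa [HasDirDeriv] using tendsto_const_nhds
  · have hlim : Tendsto (fun t : ℝ => t * c) (𝓝[≠] 0) (𝓝[≠] 0) := by
      refine tendsto_nhdsWithin_of_tendsto_nhds_of_eventually_within _ ?_ ?_
      · have : Tendsto (fun t : ℝ => t * c) (𝓝 0) (𝓝 (0 * c)) :=
          (continuous_id.mul continuous_const).tendsto 0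
        rw [zero_mul] at this
        exact this.mono_left nhdsWithin_le_nhds
      · filter_upwards [self_mem_nhdsWithin] with t ht
        exact mul_ne_zero ht hc
    refine Tendsto.congr (fun t => ?_) ((hf.comp hlim).const_smul c)
    simp only [Function.comp_apply, smul_smul, mul_inv]
    congr 1
    field_simp

theorem hasDirDeriv_smul_direction [ContinuousSMul ℝ F] [T2Space F] {f : E → F} {f' : E → E → F}
    {U : Set E} (hd : ∀ u ∈ U, ∀ h, HasDirDeriv f u h (f' u h)) {u : E} (hu : u ∈ U)
    (c : ℝ) (h : E) : f' u (c • h) = c • f' u h :=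
  (hd u hu (c • h)).unique ((hd u hu h).smul_direction c)

theorem hasDirDeriv_iff_hasDerivAt {F : Type*} [NormedAddCommGroup F] [NormedSpace ℝ F]
    {c : ℝ → F} {y : F} {s : ℝ} : HasDirDeriv c s 1 y ↔ HasDerivAt c y s := by
  rw [hasDerivAt_iff_tendsto_slope_zero]
  simp [HasDirDeriv]

theorem hasDirDeriv_iff_line {f : E → F} {x h : E} {y : F} :
    HasDirDeriv f x h y ↔ HasDirDeriv (fun s : ℝ => f (x + s • h)) 0 1 y := by
  simp [HasDirDeriv]

end DirDeriv

/-! ### Mean value theorem, linearity of the derivative and chain rule. -/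

section MeanValue

variable {D E F : Type*} [AddCommGroup D] [Module ℝ D]
  [AddCommGroup E] [Module ℝ E]
  [AddCommGroup F] [Module ℝ F] [TopologicalSpace F] [IsTopologicalAddGroup F]
  [ContinuousSMul ℝ F]

/-- Mean value theorem with values in a topological vector space. -/
theorem slope_mem_of_hasDirDeriv_mem {f : E → F} {f' : ℝ → F} {C : Set F} (hCo : IsOpen C)
    (hCc : Convex ℝ C) {u h : E} {s : ℝ} (hs : s ≠ 0)
    (hd : ∀ r ∈ Set.Icc (0 : ℝ) 1, HasDirDeriv f (u + (r * s) • h) h (f' r))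
    (hC : ∀ r ∈ Set.Icc (0 : ℝ) 1, f' r ∈ C) : s⁻¹ • (f (u + s • h) - f u) ∈ C := by
  by_contra hmem
  -- A functional `l` strictly separates the slope from the open convex set. The scalar mean value
  -- theorem for `l ∘ f` on the segment then equates `l` of the slope with `l` of a derivative lying
  -- in `C`, which contradicts the separation.
  obtain ⟨l, hl⟩ := geometric_hahn_banach_open_point hCc hCo hmem
  have hder : ∀ r ∈ Set.Icc (0 : ℝ) 1,
      HasDerivAt (fun r : ℝ => l (f (u + (r * s) • h))) (s * l (f' r)) r := by
    intro r hr
    rw [hasDerivAt_iff_tendsto_slope_zero]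
    have h1 := ((hd r hr).smul_direction s).clm_comp l
    rw [map_smul, smul_eq_mul] at h1
    refine Tendsto.congr (fun t => ?_) h1
    rw [add_mul, add_smul, ← add_assoc, smul_smul]
  obtain ⟨c, hc, hslope⟩ := exists_hasDerivAt_eq_slope (fun r : ℝ => l (f (u + (r * s) • h)))
    (fun r => s * l (f' r)) zero_lt_one
    (fun r hr => (hder r hr).continuousAt.continuousWithinAt)
    (fun r hr => hder r (Set.Ioo_subset_Icc_self hr))
  have hlt := hl _ (hC c (Set.Ioo_subset_Icc_self hc))
  simp only [one_mul, zero_mul, zero_smul, add_zero, sub_zero, div_one] at hslope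
  rw [map_smul, map_sub, smul_eq_mul, ← hslope, inv_mul_cancel_left₀ hs] at hlt
  exact lt_irrefl _ hlt

theorem exists_convex_open_subset_of_mem_nhds [LocallyConvexSpace ℝ F] {y : F} {N : Set F}
    (hN : N ∈ 𝓝 y) : ∃ C : Set F, IsOpen C ∧ Convex ℝ C ∧ y ∈ C ∧ C ⊆ N := by
  have h0 : (fun z => y + z) ⁻¹' N ∈ 𝓝 (0 : F) := by
    refine (continuous_const.add continuous_id).continuousAt.preimage_mem_nhds ?_
    simpa using hN
  obtain ⟨C, ⟨hC0, hCo, hCc⟩, hCN⟩ :=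
    (LocallyConvexSpace.convex_open_basis_zero ℝ F).mem_iff.1 h0
  refine ⟨(fun z => -y + z) ⁻¹' C, hCo.preimage (continuous_const.add continuous_id),
    hCc.translate_preimage_right (-y), by simpa using hC0, fun z hz => ?_⟩
  have := hCN hz
  simpa using this

variable [TopologicalSpace E] [IsTopologicalAddGroup E] [ContinuousSMul ℝ E]
  [LocallyConvexSpace ℝ F]

/-- Joint continuity of difference quotients of a `C¹` map. -/
theorem tendsto_slope_of_continuousOn {ι : Type*} {l : Filter ι} {f : E → F} {f' : E → E → F}
    {U : Set E} (hU : IsOpen U) (hd : ∀ u ∈ U, ∀ h, HasDirDeriv f u h (f' u h))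
    (hc : ContinuousOn (fun p : E × E => f' p.1 p.2) (U ×ˢ Set.univ)) {u₀ h₀ : E} (hu₀ : u₀ ∈ U)
    {u h : ι → E} {s : ι → ℝ} (hu : Tendsto u l (𝓝 u₀)) (hh : Tendsto h l (𝓝 h₀))
    (hs : Tendsto s l (𝓝[≠] 0)) :
    Tendsto (fun i => (s i)⁻¹ • (f (u i + s i • h i) - f (u i))) l (𝓝 (f' u₀ h₀)) := by
  intro N hN
  obtain ⟨C, hCo, hCc, hyC, hCN⟩ := exists_convex_open_subset_of_mem_nhds hN
  have hV : ∀ᶠ p : E × E in 𝓝 (u₀, h₀), p.1 ∈ U ∧ f' p.1 p.2 ∈ C := by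
    have hUV : U ×ˢ (Set.univ : Set E) ∈ 𝓝 (u₀, h₀) :=
      (hU.prod isOpen_univ).mem_nhds ⟨hu₀, trivial⟩
    filter_upwards [hUV, (hc.continuousAt hUV).preimage_mem_nhds (hCo.mem_nhds hyC)] with p h1 h2
    exact ⟨h1.1, h2⟩
  -- At step size 0 the segment collapses to the base point, where the condition holds; compactness
  -- of [0, 1] makes the neighborhood uniform in `r`.
  have hK : ∀ᶠ q : E × E × ℝ in 𝓝 (u₀, h₀, 0), ∀ r ∈ Set.Icc (0 : ℝ) 1,
      q.1 + (r * q.2.2) • q.2.1 ∈ U ∧ f' (q.1 + (r * q.2.2) • q.2.1) q.2.1 ∈ C := by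
    refine isCompact_Icc.eventually_forall_of_forall_eventually fun r _ => ?_
    have hcont : Continuous (fun z : (E × E × ℝ) × ℝ =>
        (z.1.1 + (z.2 * z.1.2.2) • z.1.2.1, z.1.2.1)) := by fun_prop
    have := hcont.tendsto ((u₀, h₀, 0), r)
    simp only [mul_zero, zero_smul, add_zero] at this
    exact this.eventually hV
  have hlim : Tendsto (fun i => (u i, h i, s i)) l (𝓝 (u₀, h₀, 0)) :=
    hu.prodMk_nhds (hh.prodMk_nhds (tendsto_nhds_of_tendsto_nhdsWithin hs))
  have hne : ∀ᶠ i in l, s i ≠ 0 := eventually_mem_of_tendsto_nhdsWithin hs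
  change ∀ᶠ i in l, (s i)⁻¹ • (f (u i + s i • h i) - f (u i)) ∈ N
  filter_upwards [hlim.eventually hK, hne] with i hi hsi
  exact hCN (slope_mem_of_hasDirDeriv_mem hCo hCc hsi (fun r hr => hd _ (hi r hr).1 _)
    (fun r hr => (hi r hr).2))

/-- The increment along t(h + k) is the increment along tk from the moving point u + th plus the
increment along th from u. The first quotient converges by joint continuity of slopes. -/
theorem hasDirDeriv_add_direction [T2Space F] {f : E → F} {f' : E → E → F}
    {U : Set E} (hU : IsOpen U) (hd : ∀ u ∈ U, ∀ h, HasDirDeriv f u h (f' u h))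
    (hc : ContinuousOn (fun p : E × E => f' p.1 p.2) (U ×ˢ Set.univ)) {u : E} (hu : u ∈ U)
    (h k : E) : f' u (h + k) = f' u h + f' u k := by
  have h0 : Tendsto (fun s : ℝ => s) (𝓝[≠] 0) (𝓝[≠] 0) := tendsto_id
  have hline : Tendsto (fun s : ℝ => u + s • h) (𝓝[≠] 0) (𝓝 u) := by
    have : Continuous (fun s : ℝ => u + s • h) := by fun_prop
    have := this.tendsto 0
    rw [zero_smul, add_zero] at this
    exact this.mono_left nhdsWithin_le_nhds
  have h1 := tendsto_slope_of_continuousOn hU hd hc hu hline (tendsto_const_nhds (x := k)) h0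
  have h2 : Tendsto _ _ _ := hd u hu h
  refine (hd u hu (h + k)).unique (Tendsto.congr (fun t => ?_) (h2.add h1))
  rw [smul_add, ← add_assoc]
  module

/-- Chain rule for a `C¹` map after a map with a directional derivative. -/
theorem HasDirDeriv.comp_of_continuousOn {f : E → F} {f' : E → E → F} {g : D → E} {x k : D}
    {z : E} {U : Set E} (hg : HasDirDeriv g x k z) (hU : IsOpen U)
    (hd : ∀ u ∈ U, ∀ h, HasDirDeriv f u h (f' u h))
    (hc : ContinuousOn (fun p : E × E => f' p.1 p.2) (U ×ˢ Set.univ)) (hx : g x ∈ U) :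
    HasDirDeriv (fun a => f (g a)) x k (f' (g x) z) := by
  -- The base point stays fixed, and the difference quotient of `g` plays the role of the varying
  -- direction.
  refine Tendsto.congr' ?_ (tendsto_slope_of_continuousOn hU hd hc hx
    (tendsto_const_nhds (x := g x)) hg tendsto_id)
  filter_upwards [self_mem_nhdsWithin] with t ht
  simp only [id]
  rw [smul_smul, mul_inv_cancel₀ ht, one_smul, add_sub_cancel]

theorem eventually_line_mem {U : Set E} (hU : IsOpen U) {u : E} (hu : u ∈ U) (h : E) :
    ∀ᶠ t : ℝ in 𝓝 0, u + t • h ∈ U := by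
  have hcont : Continuous (fun s : ℝ => u + s • h) := by fun_prop
  exact hcont.continuousAt.preimage_mem_nhds (hU.mem_nhds (by simpa using hu))

end MeanValue

theorem continuousOn_param_comp {E E' X Y F : Type*} [TopologicalSpace E] [TopologicalSpace E']
    [TopologicalSpace X] [TopologicalSpace Y] [TopologicalSpace F] {U : Set E} {b : E → X × E' → F} {m : E → Y → E'}
    (hb : ContinuousOn (fun p : E × (X × E') => b p.1 p.2) (U ×ˢ Set.univ))
    (hm : ContinuousOn (fun p : E × Y => m p.1 p.2) (U ×ˢ Set.univ)) :
    ContinuousOn (fun p : E × (X × Y) => b p.1 (p.2.1, m p.1 p.2.2)) (U ×ˢ Set.univ) := by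
  refine hb.comp (f := fun p : E × (X × Y) => (p.1, (p.2.1, m p.1 p.2.2)))
    (continuousOn_fst.prodMk ((continuous_fst.comp continuous_snd).continuousOn.prodMk ?_))
    (fun p hp => ⟨hp.1, trivial⟩)
  exact hm.comp (f := fun p : E × (X × Y) => (p.1, p.2.2)) (by fun_prop)
    (fun p hp => ⟨hp.1, trivial⟩)

theorem continuousOn_param_reindex {E X X' F : Type*} [TopologicalSpace E] [TopologicalSpace X]
    [TopologicalSpace X'] [TopologicalSpace F] {U : Set E} {g : E → X → F}
    (hg : ContinuousOn (fun p : E × X => g p.1 p.2) (U ×ˢ Set.univ)) {r : X' → X}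
    (hr : Continuous r) :
    ContinuousOn (fun p : E × X' => g p.1 (r p.2)) (U ×ˢ Set.univ) :=
  hg.comp (f := fun p : E × X' => (p.1, r p.2)) (by fun_prop) (fun _ hp => ⟨hp.1, trivial⟩)

/-! ### Maps of class `C^n` with a topological parameter -/

section ParamCk

universe u v w

/-- `f : E → X → F` is of class `C^n` on `U ⊆ E` in the first variable, with iterated directional
derivatives that depend continuously on the parameter in `X` as well. -/
def ParamCk {E : Type u} {F : Type v} [AddCommGroup E] [Module ℝ E] [TopologicalSpace E]
    [AddCommGroup F] [Module ℝ F] [TopologicalSpace F] (U : Set E) :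
    ℕ → ∀ {X : Type u} [TopologicalSpace X], (E → X → F) → Prop
  | 0, X, _, f => ContinuousOn (fun p : E × X => f p.1 p.2) (U ×ˢ Set.univ)
  | n + 1, X, _, f => ContinuousOn (fun p : E × X => f p.1 p.2) (U ×ˢ Set.univ) ∧
      (∀ u ∈ U, ∀ x h, ∃ y, HasDirDeriv (fun z => f z x) u h y) ∧
      ParamCk U n (fun (u : E) (p : X × E) => dirDeriv (fun z => f z p.1) u p.2)

variable {E E' : Type u} {X X' Y : Type u} {F : Type v} {F' : Type w}
  [AddCommGroup E] [Module ℝ E] [TopologicalSpace E]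
  [AddCommGroup E'] [Module ℝ E'] [TopologicalSpace E']
  [TopologicalSpace X] [TopologicalSpace X'] [TopologicalSpace Y]
  [AddCommGroup F] [Module ℝ F] [TopologicalSpace F]
  [AddCommGroup F'] [Module ℝ F'] [TopologicalSpace F']
  {U V : Set E} {n : ℕ}

theorem paramCk_zero_iff {f : E → X → F} : ParamCk U 0 f ↔
    ContinuousOn (fun p : E × X => f p.1 p.2) (U ×ˢ Set.univ) :=
  Iff.rfl

theorem paramCk_succ_iff {f : E → X → F} : ParamCk U (n + 1) f ↔
    ContinuousOn (fun p : E × X => f p.1 p.2) (U ×ˢ Set.univ) ∧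
      (∀ u ∈ U, ∀ x h, ∃ y, HasDirDeriv (fun z => f z x) u h y) ∧
      ParamCk U n (fun (u : E) (p : X × E) => dirDeriv (fun z => f z p.1) u p.2) :=
  Iff.rfl

attribute [irreducible] ParamCk

theorem ParamCk.continuousOn {f : E → X → F} (hf : ParamCk U n f) :
    ContinuousOn (fun p : E × X => f p.1 p.2) (U ×ˢ Set.univ) := by
  cases n with
  | zero => exact paramCk_zero_iff.1 hf
  | succ n => exact (paramCk_succ_iff.1 hf).1

theorem ParamCk.exists_hasDirDeriv {f : E → X → F} (hf : ParamCk U (n + 1) f) {u : E}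
    (hu : u ∈ U) (x : X) (h : E) : ∃ y, HasDirDeriv (fun z => f z x) u h y :=
  (paramCk_succ_iff.1 hf).2.1 u hu x h

theorem ParamCk.hasDirDeriv [T2Space F] {f : E → X → F} (hf : ParamCk U (n + 1) f) {u : E}
    (hu : u ∈ U) (x : X) (h : E) :
    HasDirDeriv (fun z => f z x) u h (dirDeriv (fun z => f z x) u h) := by
  obtain ⟨y, hy⟩ := hf.exists_hasDirDeriv hu x h
  rwa [hy.dirDeriv_eq]

theorem ParamCk.dirDeriv {f : E → X → F} (hf : ParamCk U (n + 1) f) :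
    ParamCk U n (fun (u : E) (p : X × E) => dirDeriv (fun z => f z p.1) u p.2) :=
  (paramCk_succ_iff.1 hf).2.2

theorem ParamCk.continuousOn_dirDeriv {f : E → X → F} (hf : ParamCk U (n + 1) f) (x : X) :
    ContinuousOn (fun p : E × E => _root_.dirDeriv (fun z => f z x) p.1 p.2)
      (U ×ˢ Set.univ) :=
  hf.dirDeriv.continuousOn.comp (f := fun p : E × E => (p.1, (x, p.2))) (by fun_prop)
    (fun _ hp => ⟨hp.1, trivial⟩)

theorem ParamCk.dirDeriv_smul [ContinuousSMul ℝ F] [T2Space F] {f : E → X → F}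
    (hf : ParamCk U (n + 1) f) {u : E} (hu : u ∈ U) (x : X) (c : ℝ) (h : E) :
    _root_.dirDeriv (fun z => f z x) u (c • h) = c • _root_.dirDeriv (fun z => f z x) u h :=
  hasDirDeriv_smul_direction (fun _ hu h => hf.hasDirDeriv hu x h) hu c h

theorem ParamCk.of_succ {f : E → X → F} (hf : ParamCk U (n + 1) f) : ParamCk U n f := by
  induction n generalizing X with
  | zero => exact paramCk_zero_iff.2 hf.continuousOn
  | succ n ih =>
    exact paramCk_succ_iff.2 ⟨hf.continuousOn, fun _ hu => hf.exists_hasDirDeriv hu,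
      ih hf.dirDeriv⟩

theorem ParamCk.mono (hVU : V ⊆ U) {f : E → X → F} (hf : ParamCk U n f) : ParamCk V n f := by
  have hc := hf.continuousOn.mono (Set.prod_mono hVU (subset_refl (Set.univ : Set X)))
  induction n generalizing X with
  | zero => exact paramCk_zero_iff.2 hc
  | succ n ih =>
    exact paramCk_succ_iff.2 ⟨hc, fun u hu => hf.exists_hasDirDeriv (hVU hu),
      ih hf.dirDeriv (hf.dirDeriv.continuousOn.mono
        (Set.prod_mono hVU (subset_refl (Set.univ : Set (X × E)))))⟩

theorem ParamCk.reindex {f : E → X → F} (hf : ParamCk U n f) {r : X' → X} (hr : Continuous r) :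
    ParamCk U n (fun u x => f u (r x)) := by
  induction n generalizing X X' with
  | zero => exact paramCk_zero_iff.2 (continuousOn_param_reindex hf.continuousOn hr)
  | succ n ih =>
    refine paramCk_succ_iff.2 ⟨continuousOn_param_reindex hf.continuousOn hr,
      fun u hu x h => hf.exists_hasDirDeriv hu (r x) h, ?_⟩
    have hr' : Continuous (fun p : X' × E => (r p.1, p.2)) := by fun_prop
    have := ih hf.dirDeriv hr'
    exact this

/-- Inversion and automorphisms of G need not map a chart domain into a single chart, so expressions
involving them are controlled only near each point. -/
theorem ParamCk.of_locally {f : E → X → F}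
    (hf : ∀ u ∈ U, ∃ V, IsOpen V ∧ u ∈ V ∧ ParamCk V n f) : ParamCk U n f := by
  have hcont : ContinuousOn (fun p : E × X => f p.1 p.2) (U ×ˢ Set.univ) := by
    rintro ⟨u, x⟩ ⟨hu, -⟩
    obtain ⟨V, hVo, huV, hV⟩ := hf u hu
    exact (hV.continuousOn.continuousAt
      ((hVo.prod isOpen_univ).mem_nhds ⟨huV, trivial⟩)).continuousWithinAt
  induction n generalizing X with
  | zero => exact paramCk_zero_iff.2 hcont
  | succ n ih =>
    have hloc : ∀ u ∈ U, ∃ V, IsOpen V ∧ u ∈ V ∧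
        ParamCk V n (fun (u : E) (p : X × E) => _root_.dirDeriv (fun z => f z p.1) u p.2) :=
      fun u hu => (hf u hu).imp fun V hV => ⟨hV.1, hV.2.1, hV.2.2.dirDeriv⟩
    refine paramCk_succ_iff.2 ⟨hcont, fun u hu => ?_, ih hloc ?_⟩
    · obtain ⟨V, -, huV, hV⟩ := hf u hu
      exact hV.exists_hasDirDeriv huV
    · rintro ⟨u, x⟩ ⟨hu, -⟩
      obtain ⟨V, hVo, huV, hV⟩ := hloc u hu
      exact (hV.continuousOn.continuousAt
        ((hVo.prod isOpen_univ).mem_nhds ⟨huV, trivial⟩)).continuousWithinAt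

section

variable [IsTopologicalAddGroup E] [ContinuousSMul ℝ E]

theorem ParamCk.congr (hU : IsOpen U) {f g : E → X → F} (hf : ParamCk U n f)
    (hfg : ∀ u ∈ U, ∀ x, f u x = g u x) : ParamCk U n g := by
  have hc := hf.continuousOn.congr fun p hp => (hfg p.1 hp.1 p.2).symm
  induction n generalizing X with
  | zero => exact paramCk_zero_iff.2 hc
  | succ n ih =>
    have hline : ∀ u ∈ U, ∀ x h, ∀ᶠ t : ℝ in 𝓝 0, f (u + t • h) x = g (u + t • h) x :=
      fun u hu x h => (eventually_line_mem hU hu h).mono fun t ht => hfg _ ht x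
    have hdd : ∀ u ∈ U, ∀ p : X × E, _root_.dirDeriv (fun z => f z p.1) u p.2 =
        _root_.dirDeriv (fun z => g z p.1) u p.2 :=
      fun u hu p => dirDeriv_congr (hline u hu p.1 p.2)
    refine paramCk_succ_iff.2 ⟨hc, fun u hu x h => ?_, ih hf.dirDeriv hdd
      (hf.dirDeriv.continuousOn.congr fun p hp => (hdd p.1 hp.1 p.2).symm)⟩
    obtain ⟨y, hy⟩ := hf.exists_hasDirDeriv hu x h
    exact ⟨y, hy.congr (hline u hu x h)⟩

variable [T2Space F]

theorem ParamCk.succ_of_hasDirDeriv (hU : IsOpen U) {f : E → X → F} {f' : E → X × E → F}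
    (hc : ContinuousOn (fun p : E × X => f p.1 p.2) (U ×ˢ Set.univ))
    (hd : ∀ u ∈ U, ∀ x h, HasDirDeriv (fun z => f z x) u h (f' u (x, h)))
    (hf' : ParamCk U n f') : ParamCk U (n + 1) f :=
  paramCk_succ_iff.2 ⟨hc, fun u hu x h => ⟨_, hd u hu x h⟩,
    hf'.congr hU fun u hu p => ((hd u hu p.1 p.2).dirDeriv_eq).symm⟩

theorem ParamCk.clm_comp [T2Space F'] (hU : IsOpen U) (L : F →L[ℝ] F') {f : E → X → F}
    (hf : ParamCk U n f) : ParamCk U n (fun u x => L (f u x)) := by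
  induction n generalizing X with
  | zero => exact paramCk_zero_iff.2 (L.continuous.comp_continuousOn hf.continuousOn)
  | succ n ih =>
    exact succ_of_hasDirDeriv hU (L.continuous.comp_continuousOn hf.continuousOn)
      (fun u hu x h => (hf.hasDirDeriv hu x h).clm_comp L) (ih hf.dirDeriv)

theorem ParamCk.add [IsTopologicalAddGroup F] (hU : IsOpen U) {f g : E → X → F}
    (hf : ParamCk U n f) (hg : ParamCk U n g) : ParamCk U n (fun u x => f u x + g u x) := by
  induction n generalizing X with
  | zero => exact paramCk_zero_iff.2 (hf.continuousOn.add hg.continuousOn)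
  | succ n ih =>
    exact succ_of_hasDirDeriv hU (hf.continuousOn.add hg.continuousOn)
      (fun u hu x h => (hf.hasDirDeriv hu x h).add (hg.hasDirDeriv hu x h))
      (ih hf.dirDeriv hg.dirDeriv)

theorem ParamCk.prodMk [T2Space F'] (hU : IsOpen U) {f : E → X → F} {g : E → X → F'}
    (hf : ParamCk U n f) (hg : ParamCk U n g) : ParamCk U n (fun u x => (f u x, g u x)) := by
  induction n generalizing X with
  | zero => exact paramCk_zero_iff.2 (hf.continuousOn.prodMk hg.continuousOn)
  | succ n ih =>
    exact succ_of_hasDirDeriv hU (hf.continuousOn.prodMk hg.continuousOn)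
      (fun u hu x h => (hf.hasDirDeriv hu x h).prodMk (hg.hasDirDeriv hu x h))
      (ih hf.dirDeriv hg.dirDeriv)

theorem paramCk_const (hU : IsOpen U) {a : X → F} (ha : Continuous a) :
    ParamCk U n (fun (_ : E) x => a x) := by
  induction n generalizing X with
  | zero => exact paramCk_zero_iff.2 (ha.comp continuous_snd).continuousOn
  | succ n ih =>
    exact ParamCk.succ_of_hasDirDeriv hU (ha.comp continuous_snd).continuousOn
      (fun u _ x h => hasDirDeriv_const (a x) u h) (ih (X := X × E) continuous_const)

theorem paramCk_id [T2Space E] (hU : IsOpen U) : ParamCk U n (fun (u : E) (_ : X) => u) := by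
  cases n with
  | zero => exact paramCk_zero_iff.2 continuous_fst.continuousOn
  | succ n =>
    exact ParamCk.succ_of_hasDirDeriv hU continuous_fst.continuousOn
      (fun u _ _ h => hasDirDeriv_id u h) (paramCk_const hU continuous_snd)

end

section

variable [IsTopologicalAddGroup E] [ContinuousSMul ℝ E]
  [IsTopologicalAddGroup F] [ContinuousSMul ℝ F] [T2Space F]

/-- Substitution of a `C^n` map into a variable in which a `C^n` map is linear. -/
theorem ParamCk.linear_comp [T2Space E'] (hU : IsOpen U) {b : E → X × E' → F} {m : E → Y → E'}
    (hb : ParamCk U n b) (hm : ParamCk U n m)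
    (hadd : ∀ u ∈ U, ∀ x z z', b u (x, z + z') = b u (x, z) + b u (x, z'))
    (hsmul : ∀ u ∈ U, ∀ x (c : ℝ) z, b u (x, c • z) = c • b u (x, z)) :
    ParamCk U n (fun u (p : X × Y) => b u (p.1, m u p.2)) := by
  induction n generalizing X Y with
  | zero => exact paramCk_zero_iff.2 (continuousOn_param_comp hb.continuousOn hm.continuousOn)
  | succ n ih =>
    have hsub : ∀ u ∈ U, ∀ x z z', b u (x, z - z') = b u (x, z) - b u (x, z') := by
      intro u hu x z z'
      rw [eq_sub_iff_add_eq, ← hadd u hu, sub_add_cancel]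
    refine succ_of_hasDirDeriv (f' := fun u q =>
      _root_.dirDeriv (fun z => b z (q.1.1, m u q.1.2)) u q.2 +
        b u (q.1.1, _root_.dirDeriv (fun z => m z q.1.2) u q.2)) hU
        (continuousOn_param_comp hb.continuousOn hm.continuousOn) ?_ ?_
    -- By linearity the quotient is that of `b` with `m u y` frozen, plus `b` at u + th applied to
    -- the difference quotient of `m`. The second term converges by joint continuity of `b`; no
    -- derivative in the linear slot is taken.
    · rintro u hu ⟨x, y⟩ h
      have h1 : Tendsto _ _ _ := hb.hasDirDeriv hu (x, m u y) h
      have h2 : Tendsto _ _ _ := hm.hasDirDeriv hu y h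
      have hlim : Tendsto (fun t : ℝ => (u + t • h, (x, t⁻¹ • (m (u + t • h) y - m u y))))
          (𝓝[≠] 0) (𝓝 (u, (x, _root_.dirDeriv (fun z => m z y) u h))) := by
        have hl : Continuous (fun s : ℝ => u + s • h) := by fun_prop
        have hl := hl.tendsto 0
        rw [zero_smul, add_zero] at hl
        exact (hl.mono_left nhdsWithin_le_nhds).prodMk_nhds (tendsto_const_nhds.prodMk_nhds h2)
      have hcb := (hb.continuousOn.continuousAt ((hU.prod isOpen_univ).mem_nhds ⟨hu, trivial⟩)).tendsto.comp
        hlim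
      refine Tendsto.congr' ?_ (h1.add hcb)
      filter_upwards [nhdsWithin_le_nhds (eventually_line_mem hU hu h)] with t ht
      simp only [Function.comp_apply]
      rw [hsmul _ ht, hsub _ ht, ← smul_add]
      congr 1
      abel
    -- Both summands fall under the induction hypothesis: the derivative of `b` in u is still linear
    -- in the slot, and in the other summand only `m` is replaced by its derivative.
    · refine ParamCk.add hU ?_ ?_
      · have hb' : ParamCk U n (fun u (q : (X × E) × E') =>
            _root_.dirDeriv (fun z => b z (q.1.1, q.2)) u q.1.2) :=
          hb.dirDeriv.reindex (X' := (X × E) × E')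
            (r := fun q => ((q.1.1, q.2), q.1.2)) (by fun_prop)
        have := ih hb' hm.of_succ ?_ ?_
        · exact this.reindex (X' := (X × Y) × E) (r := fun q => ((q.1.1, q.2), q.1.2))
            (by fun_prop)
        · intro u hu x z z'
          refine HasDirDeriv.dirDeriv_eq (HasDirDeriv.congr
            ((hb.hasDirDeriv hu (x.1, z) x.2).add (hb.hasDirDeriv hu (x.1, z') x.2)) ?_)
          filter_upwards [eventually_line_mem hU hu x.2] with t ht
          rw [hadd _ ht]
        · intro u hu x c z
          refine HasDirDeriv.dirDeriv_eq (HasDirDeriv.congr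
            ((hb.hasDirDeriv hu (x.1, z) x.2).const_smul c) ?_)
          filter_upwards [eventually_line_mem hU hu x.2] with t ht
          rw [hsmul _ ht]
      · have := ih hb.of_succ hm.dirDeriv hadd hsmul
        exact this.reindex (X' := (X × Y) × E) (r := fun q => (q.1.1, (q.1.2, q.2)))
          (by fun_prop)

end

section

variable [IsTopologicalAddGroup E] [ContinuousSMul ℝ E]
  [IsTopologicalAddGroup E'] [ContinuousSMul ℝ E'] [T2Space E']
  [IsTopologicalAddGroup F] [ContinuousSMul ℝ F] [LocallyConvexSpace ℝ F] [T2Space F]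

theorem ParamCk.dirDeriv_add (hU : IsOpen U) {f : E → X → F} (hf : ParamCk U (n + 1) f) {u : E}
    (hu : u ∈ U) (x : X) (h k : E) : _root_.dirDeriv (fun z => f z x) u (h + k) =
      _root_.dirDeriv (fun z => f z x) u h + _root_.dirDeriv (fun z => f z x) u k :=
  hasDirDeriv_add_direction hU (fun _ hu h => hf.hasDirDeriv hu x h)
    (hf.continuousOn_dirDeriv x) hu h k

theorem ParamCk.hasDirDeriv_comp {D : Type*} [AddCommGroup D] [Module ℝ D] (hU : IsOpen U)
    {f : E → X → F} (hf : ParamCk U (n + 1) f) (x : X) {g : D → E} {a k : D} {z : E}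
    (hg : HasDirDeriv g a k z) (ha : g a ∈ U) :
    HasDirDeriv (fun d => f (g d) x) a k (_root_.dirDeriv (fun z => f z x) (g a) z) :=
  hg.comp_of_continuousOn hU (fun _ hu h => hf.hasDirDeriv hu x h)
    (hf.continuousOn_dirDeriv x) ha

/-- Composition of `C^n` maps. -/
theorem ParamCk.comp {W : Set E'} (hU : IsOpen U) (hW : IsOpen W) {f : E' → X → F} {g : E → E'}
    (hf : ParamCk W n f) (hg : ParamCk U n (fun u (_ : PUnit.{u + 1}) => g u))
    (hgW : ∀ u ∈ U, g u ∈ W) : ParamCk U n (fun u x => f (g u) x) := by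
  have hgc : ContinuousOn g U :=
    hg.continuousOn.comp (f := fun u => (u, PUnit.unit)) (by fun_prop) (fun u hu => ⟨hu, trivial⟩)
  have hcont : ContinuousOn (fun p : E × X => f (g p.1) p.2) (U ×ˢ Set.univ) :=
    hf.continuousOn.comp (f := fun p : E × X => (g p.1, p.2))
      ((hgc.comp continuousOn_fst fun p hp => hp.1).prodMk continuousOn_snd)
      (fun p hp => ⟨hgW _ hp.1, trivial⟩)
  induction n generalizing X with
  | zero => exact paramCk_zero_iff.2 hcont
  | succ n ih =>
    refine succ_of_hasDirDeriv (f' := fun u (q : X × E) =>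
      _root_.dirDeriv (fun z => f z q.1) (g u) (_root_.dirDeriv g u q.2)) hU hcont
      (fun u hu x h => hf.hasDirDeriv_comp hW x (hg.hasDirDeriv hu PUnit.unit h) (hgW u hu)) ?_
    -- The induction hypothesis, used with the direction as an extra parameter, handles the
    -- derivative of `f` along `g`. The inner derivative of `g` is then inserted into the direction,
    -- in which that derivative is linear.
    have hdf : ParamCk U n
        (fun u (p : X × E') => _root_.dirDeriv (fun z => f z p.1) (g u) p.2) :=
      ih (f := fun (u : E') (p : X × E') => _root_.dirDeriv (fun z => f z p.1) u p.2)
        hf.dirDeriv hg.of_succ (ContinuousOn.comp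
        (g := fun p : E' × (X × E') => _root_.dirDeriv (fun z => f z p.2.1) p.1 p.2.2)
        (f := fun p : E × (X × E') => (g p.1, p.2)) hf.dirDeriv.continuousOn
        ((hgc.comp continuousOn_fst fun p hp => hp.1).prodMk continuousOn_snd)
        (fun p hp => ⟨hgW _ hp.1, trivial⟩))
    have hdg : ParamCk U n (fun u (h : E) => _root_.dirDeriv g u h) :=
      hg.dirDeriv.reindex (r := fun h : E => (PUnit.unit, h)) (by fun_prop)
    have := hdf.linear_comp hU hdg
      (fun u hu x z z' => hf.dirDeriv_add hW (hgW u hu) x z z')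
      (fun u hu x c z => hf.dirDeriv_smul (hgW u hu) x c z)
    exact this

end

section

variable [IsTopologicalAddGroup E] [ContinuousSMul ℝ E] [T2Space F]

/-- The tuple of directions of the j-th derivative serves as the parameter, and one further
differentiation appends its direction as last entry. Conversely, iterating `dirDeriv` on the last
direction produces the required family. `PUnit` stands for the absence of a parameter. -/
theorem smoothOnLC_iff_paramCk (hU : IsOpen U) {f : E → F} :
    SmoothOnLC f U ↔ ∀ n, ParamCk U n (fun u (_ : PUnit.{u + 1}) => f u) := by
  constructor
  · rintro ⟨D, hD0, hD, hDc⟩ n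
    have key : ∀ n j, ParamCk U n (D j) := by
      intro n
      induction n with
      | zero => exact fun j => paramCk_zero_iff.2 (hDc j)
      | succ n ih =>
        intro j
        refine ParamCk.succ_of_hasDirDeriv (f' := fun u q => D (j + 1) u (Fin.snoc q.1 q.2)) hU
          (hDc j) (fun u hu x h => ?_) ?_
        · have := hD j u hu (Fin.snoc x h)
          rwa [Fin.init_snoc, Fin.snoc_last] at this
        · refine (ih (j + 1)).reindex (r := fun q : (Fin j → E) × E =>
            (Fin.snoc q.1 q.2 : Fin (j + 1) → E)) (continuous_pi fun i => ?_)
          refine Fin.lastCases ?_ (fun i => ?_) i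
          · simpa using continuous_snd
          · simp only [Fin.snoc_castSucc]
            fun_prop
    exact ((key n 0).reindex (r := fun _ : PUnit.{u + 1} => Fin.elim0)
      continuous_const).congr hU fun u hu _ => hD0 u hu _
  · intro hf
    let D : (j : ℕ) → E → (Fin j → E) → F := fun j => Nat.rec (fun u _ => f u)
      (fun j Dj u h => dirDeriv (fun z => Dj z (Fin.init h)) u (h (Fin.last j))) j
    have hD : ∀ j n, ParamCk U n (D j) := by
      intro j
      induction j with
      | zero => exact fun n => (hf n).reindex (r := fun _ => PUnit.unit) continuous_const
      | succ j ih =>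
        intro n
        refine (ih (n + 1)).dirDeriv.reindex
          (r := fun h : Fin (j + 1) → E => (Fin.init h, h (Fin.last j)))
          (Continuous.prodMk (continuous_pi fun i => ?_) (by fun_prop))
        exact continuous_apply _
    exact ⟨D, fun _ _ _ => rfl, fun j u hu h => (hD j 1).hasDirDeriv hu _ _,
      fun j => (hD j 0).continuousOn⟩

end

end ParamCk

/-! ### Smooth families of vectors of a unitary representation -/

section UnitaryRep

variable {G H : Type*} [Group G] [NormedAddCommGroup H] [InnerProductSpace ℂ H] [CompleteSpace H]

theorem unitaryRep_mul_apply (π : G →* unitary (H →L[ℂ] H)) (g h : G) (v : H) :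
    (π (g * h) : H →L[ℂ] H) v = (π g : H →L[ℂ] H) ((π h : H →L[ℂ] H) v) := by
  simp

theorem unitaryRep_norm_apply (π : G →* unitary (H →L[ℂ] H)) (g : G) (v : H) :
    ‖(π g : H →L[ℂ] H) v‖ = ‖v‖ :=
  ContinuousLinearMap.norm_map_of_mem_unitary (π g).2 v

end UnitaryRep

section SmoothFamily

universe u

variable {E : Type u} {G H : Type*} [AddCommGroup E] [Module ℝ E] [TopologicalSpace E]
  [TopologicalSpace G] [ChartedSpace E G] [Group G]
  [NormedAddCommGroup H] [InnerProductSpace ℂ H] [CompleteSpace H]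

/-- A family `w : X → H` of vectors is smooth if in every chart the orbit maps are smooth, with
derivatives that depend continuously on the parameter. -/
def SmoothFamily (E : Type u) {G H : Type*} [AddCommGroup E] [Module ℝ E] [TopologicalSpace E]
    [TopologicalSpace G] [ChartedSpace E G] [Group G]
    [NormedAddCommGroup H] [InnerProductSpace ℂ H] [CompleteSpace H]
    (π : G →* unitary (H →L[ℂ] H)) {X : Type u} [TopologicalSpace X] (w : X → H) : Prop :=
  ∀ e ∈ atlas E G, ∀ n, ParamCk e.target n (fun u x => (π (e.symm u) : H →L[ℂ] H) (w x))

variable {π : G →* unitary (H →L[ℂ] H)} {X Y : Type u} [TopologicalSpace X] [TopologicalSpace Y]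

theorem SmoothFamily.reindex {w : X → H} (hw : SmoothFamily E π w) {r : Y → X}
    (hr : Continuous r) : SmoothFamily E π (fun y => w (r y)) :=
  fun e he n => (hw e he n).reindex hr

variable [IsTopologicalAddGroup E] [ContinuousSMul ℝ E]

theorem SmoothFamily.add {w w' : X → H} (hw : SmoothFamily E π w) (hw' : SmoothFamily E π w') :
    SmoothFamily E π (fun x => w x + w' x) := by
  intro e he n
  simpa only [map_add] using (hw e he n).add e.open_target (hw' e he n)

theorem SmoothFamily.const_smul {w : X → H} (hw : SmoothFamily E π w) (c : ℂ) :
    SmoothFamily E π (fun x => c • w x) := by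
  intro e he n
  have := (hw e he n).clm_comp e.open_target
    ((c • ContinuousLinearMap.id ℂ H).restrictScalars ℝ)
  simpa using this

/-- At the coordinates of 1 the operator is the identity, so the family itself is recovered from its
orbit maps. This later gives continuity of y ↦ dπ(y₁)⋯dπ(y_k)v. -/
theorem SmoothFamily.continuous {w : X → H} (hw : SmoothFamily E π w) : Continuous w := by
  have hc := (hw _ (chart_mem_atlas E (1 : G)) 0).continuousOn
  have := hc.comp_continuous (f := fun x : X => (chartAt E (1 : G) 1, x)) (by fun_prop)
    (fun x => ⟨mem_chart_target E 1, trivial⟩)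
  refine this.congr fun x => ?_
  simp [(chartAt E (1 : G)).left_inv (mem_chart_source E 1)]

/-- The subspace of smooth vectors. -/
def smoothSubmodule (E : Type u) {G H : Type*} [AddCommGroup E] [Module ℝ E] [TopologicalSpace E]
    [TopologicalSpace G] [ChartedSpace E G] [Group G]
    [NormedAddCommGroup H] [InnerProductSpace ℂ H] [CompleteSpace H]
    [IsTopologicalAddGroup E] [ContinuousSMul ℝ E] (π : G →* unitary (H →L[ℂ] H)) :
    Submodule ℂ H where
  carrier := {v | SmoothFamily E π (fun _ : PUnit.{u + 1} => v)}
  add_mem' hv hw := hv.add hw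
  zero_mem' := by
    intro e _ n
    simpa using paramCk_const e.open_target (continuous_const (y := (0 : H)))
  smul_mem' c _ hv := hv.const_smul c

theorem SmoothFamily.mem {w : X → H} (hw : SmoothFamily E π w) (x : X) :
    w x ∈ smoothSubmodule E π :=
  hw.reindex (r := fun _ => x) continuous_const

/-- The only chart of `H` is the identity, so only the charts of G matter; strong continuity of π
supplies the continuity clause in the definition of a smooth map. -/
theorem mem_smoothVectors_iff (hπ : ∀ v : H, Continuous fun g => (π g : H →L[ℂ] H) v) {v : H} :
    v ∈ smoothVectors E π ↔ v ∈ smoothSubmodule E π := by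
  have hset : ∀ e ∈ atlas E G, e.target ∩ e.symm ⁻¹' ((fun g => (π g : H →L[ℂ] H) v) ⁻¹'
      (OpenPartialHomeomorph.refl H).source) = e.target := by
    intro e _
    simp
  constructor
  · rintro ⟨-, h⟩ e he
    have := h e he _ (chartedSpaceSelf_atlas.2 rfl)
    rw [hset e he] at this
    exact (smoothOnLC_iff_paramCk e.open_target).1 this
  · refine fun h => ⟨hπ v, fun e he e' he' => ?_⟩
    obtain rfl := chartedSpaceSelf_atlas.1 he'
    rw [hset e he]
    exact (smoothOnLC_iff_paramCk e.open_target).2 (h e he)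

/-! #### Derivatives of orbit maps at the identity -/

/-- The derivative at `1` of the orbit map of `w` in the direction `y`. -/
noncomputable def orbitDeriv (π : G →* unitary (H →L[ℂ] H)) (w : H) (y : E) : H :=
  dirDeriv (fun z => (π ((chartAt E (1 : G)).symm z) : H →L[ℂ] H) w) (chartAt E (1 : G) 1) y

theorem orbitDeriv_smul {w : H} (hw : w ∈ smoothSubmodule E π) (c : ℝ) (y : E) :
    orbitDeriv π w (c • y) = c • orbitDeriv π w y :=
  (hw _ (chart_mem_atlas E (1 : G)) 1).dirDeriv_smul (mem_chart_target E 1) PUnit.unit c y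

theorem orbitDeriv_add {w : H} (hw : w ∈ smoothSubmodule E π) (y z : E) :
    orbitDeriv π w (y + z) = orbitDeriv π w y + orbitDeriv π w z :=
  (hw _ (chart_mem_atlas E (1 : G)) 1).dirDeriv_add (chartAt E (1 : G)).open_target
    (mem_chart_target E 1) PUnit.unit y z

theorem hasDirDeriv_orbitDeriv {w : H} (hw : w ∈ smoothSubmodule E π) (y : E) :
    HasDirDeriv (fun z => (π ((chartAt E (1 : G)).symm z) : H →L[ℂ] H) w) (chartAt E (1 : G) 1) y
      (orbitDeriv π w y) :=
  (hw _ (chart_mem_atlas E (1 : G)) 1).hasDirDeriv (mem_chart_target E 1) PUnit.unit y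

theorem orbitDeriv_add_vector {w w' : H} (hw : w ∈ smoothSubmodule E π)
    (hw' : w' ∈ smoothSubmodule E π) (y : E) :
    orbitDeriv π (w + w') y = orbitDeriv π w y + orbitDeriv π w' y := by
  refine HasDirDeriv.dirDeriv_eq ?_
  simpa only [map_add] using (hasDirDeriv_orbitDeriv hw y).add (hasDirDeriv_orbitDeriv hw' y)

theorem orbitDeriv_clm_apply {w w' : H} (hw : w ∈ smoothSubmodule E π) (L : H →L[ℂ] H)
    (hL : ∀ g, (π g : H →L[ℂ] H) w' = L ((π g : H →L[ℂ] H) w)) (y : E) :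
    orbitDeriv π w' y = L (orbitDeriv π w y) := by
  refine HasDirDeriv.dirDeriv_eq ?_
  simp only [hL]
  exact (hasDirDeriv_orbitDeriv hw y).clm_comp (L.restrictScalars ℝ)

theorem orbitDeriv_smul_vector {w : H} (hw : w ∈ smoothSubmodule E π) (c : ℂ) (y : E) :
    orbitDeriv π (c • w) y = c • orbitDeriv π w y :=
  orbitDeriv_clm_apply hw (c • ContinuousLinearMap.id ℂ H) (fun g => by simp) y

/-- The derivative of the orbit map along a curve that is differentiable in a chart. -/
theorem hasDerivAt_orbit_curve {w : H} (hw : w ∈ smoothSubmodule E π)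
    {e : OpenPartialHomeomorph G E} (he : e ∈ atlas E G) {c : ℝ → G} {s : ℝ} {x : E}
    (hc : ContinuousAt c s) (hs : c s ∈ e.source)
    (hd : HasDirDeriv (fun r => e (c r)) s 1 x) :
    HasDerivAt (fun r => (π (c r) : H →L[ℂ] H) w)
      (dirDeriv (fun z => (π (e.symm z) : H →L[ℂ] H) w) (e (c s)) x) s := by
  rw [← hasDirDeriv_iff_hasDerivAt]
  refine ((hw e he 1).hasDirDeriv_comp e.open_target PUnit.unit hd (e.map_source hs)).congr ?_
  have h0 : Tendsto (fun t : ℝ => s + t • (1 : ℝ)) (𝓝 0) (𝓝 s) := by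
    have : Continuous (fun t : ℝ => s + t • (1 : ℝ)) := by fun_prop
    simpa using this.tendsto 0
  filter_upwards [h0.eventually (hc.eventually (e.open_source.mem_nhds hs))] with t ht
  rw [e.left_inv ht]

theorem hasDerivAt_orbit_curve_one {w : H} (hw : w ∈ smoothSubmodule E π) {c : ℝ → G} {x : E}
    (hc : ContinuousAt c 0) (h1 : c 0 = 1)
    (hd : HasDirDeriv (fun r => chartAt E (1 : G) (c r)) 0 1 x) :
    HasDerivAt (fun r => (π (c r) : H →L[ℂ] H) w) (orbitDeriv π w x) 0 := by
  have := hasDerivAt_orbit_curve hw (chart_mem_atlas E (1 : G)) hc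
    (by rw [h1]; exact mem_chart_source E 1) hd
  rwa [h1] at this

/-! #### Left translations in charts -/

theorem isOpen_mul_chart_domain (hG : IsLCLieGroup E G) (e₁ e₂ e₃ : OpenPartialHomeomorph G E) :
    IsOpen {u : E × E | u.1 ∈ e₁.target ∧ u.2 ∈ e₂.target ∧
      e₁.symm u.1 * e₂.symm u.2 ∈ e₃.source} := by
  have hc : ContinuousOn (fun u : E × E => e₁.symm u.1 * e₂.symm u.2)
      (e₁.target ×ˢ e₂.target) :=
    hG.continuous_mul.comp_continuousOn
      ((e₁.continuousOn_symm.comp continuousOn_fst fun _ hp => hp.1).prodMk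
        (e₂.continuousOn_symm.comp continuousOn_snd fun _ hp => hp.2))
  have := hc.isOpen_inter_preimage (e₁.open_target.prod e₂.open_target) e₃.open_source
  convert this using 1
  ext u
  simp [and_assoc]

theorem paramCk_mul_chart (hG : IsLCLieGroup E G) {e₁ e₂ e₃ : OpenPartialHomeomorph G E}
    (he₁ : e₁ ∈ atlas E G) (he₂ : e₂ ∈ atlas E G) (he₃ : e₃ ∈ atlas E G) [T2Space E] (n : ℕ) :
    ParamCk {u : E × E | u.1 ∈ e₁.target ∧ u.2 ∈ e₂.target ∧
      e₁.symm u.1 * e₂.symm u.2 ∈ e₃.source} n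
      (fun u (_ : PUnit.{u + 1}) => e₃ (e₁.symm u.1 * e₂.symm u.2)) :=
  (smoothOnLC_iff_paramCk (isOpen_mul_chart_domain hG e₁ e₂ e₃)).1
    (hG.smooth_mul e₁ he₁ e₂ he₂ e₃ he₃) n

/-- Smoothness of multiplication is given on the product of charts; directions (0, h) extract from
it the derivatives of left translations. -/
theorem dirDeriv_prod_zero {F : Type*} [AddCommGroup F] [Module ℝ F] [TopologicalSpace F]
    (f : E × E → F) (a b h : E) :
    dirDeriv f (a, b) (0, h) = dirDeriv (fun z => f (a, z)) b h := by
  simp [dirDeriv]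

theorem hasDirDeriv_prod_zero {F : Type*} [AddCommGroup F] [Module ℝ F] [TopologicalSpace F]
    {f : E × E → F} {a b h : E} {y : F} :
    HasDirDeriv f (a, b) (0, h) y ↔ HasDirDeriv (fun z => f (a, z)) b h y := by
  simp [HasDirDeriv]

/-- The derivative at `y` of left translation by the point with coordinates `u`, in the chart `e`
and the preferred chart at `1`. -/
noncomputable def mulVelocity (e : OpenPartialHomeomorph G E) (u y : E) : E :=
  dirDeriv (fun z => e (e.symm u * (chartAt E (1 : G)).symm z)) (chartAt E (1 : G) 1) y

/-- The left logarithmic derivative of the inverse of the chart `e`. -/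
noncomputable def leftLogDeriv (e : OpenPartialHomeomorph G E) (u h : E) : E :=
  dirDeriv (fun z => chartAt E (1 : G) ((e.symm u)⁻¹ * e.symm z)) u h

variable [T2Space E] [LocallyConvexSpace ℝ E]

theorem hasDirDeriv_mulVelocity (hG : IsLCLieGroup E G) {e : OpenPartialHomeomorph G E}
    (he : e ∈ atlas E G) {u : E} (hu : u ∈ e.target) (y : E) :
    HasDirDeriv (fun z => e (e.symm u * (chartAt E (1 : G)).symm z)) (chartAt E (1 : G) 1) y
      (mulVelocity e u y) := by
  have hmem : (u, chartAt E (1 : G) 1) ∈ {u : E × E | u.1 ∈ e.target ∧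
      u.2 ∈ (chartAt E (1 : G)).target ∧
      e.symm u.1 * (chartAt E (1 : G)).symm u.2 ∈ e.source} := by
    refine ⟨hu, mem_chart_target E 1, ?_⟩
    simpa [(chartAt E (1 : G)).left_inv (mem_chart_source E 1)] using e.map_target hu
  have := (paramCk_mul_chart hG he (chart_mem_atlas E 1) he 1).hasDirDeriv hmem PUnit.unit (0, y)
  rwa [dirDeriv_prod_zero, hasDirDeriv_prod_zero] at this

theorem paramCk_mulVelocity (hG : IsLCLieGroup E G) {e : OpenPartialHomeomorph G E}
    (he : e ∈ atlas E G) (n : ℕ) : ParamCk e.target n (mulVelocity e) := by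
  have h1 := (paramCk_mul_chart hG he (chart_mem_atlas E 1) he (n + 1)).dirDeriv
  have hg : ParamCk e.target n (fun u (_ : PUnit.{u + 1}) => (u, chartAt E (1 : G) 1)) :=
    (paramCk_id e.open_target).prodMk e.open_target (paramCk_const e.open_target continuous_const)
  have h2 := h1.comp e.open_target (isOpen_mul_chart_domain hG e _ e) hg (fun u hu => by
    refine ⟨hu, mem_chart_target E 1, ?_⟩
    simpa [(chartAt E (1 : G)).left_inv (mem_chart_source E 1)] using e.map_target hu)
  have h3 := h2.reindex (r := fun y : E => (PUnit.unit, ((0 : E), y))) (by fun_prop)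
  simp only [dirDeriv_prod_zero] at h3
  exact h3

/-- Near the given point, inversion takes values in one chart `e'`. There the quotient of group
elements is multiplication in charts with first coordinate `i u`, and its derivative at (i u, u) in
direction (0, h) is the one sought. -/
theorem exists_leftLogDeriv_chart (hG : IsLCLieGroup E G) {e : OpenPartialHomeomorph G E}
    (he : e ∈ atlas E G) {u₀ : E} (hu₀ : u₀ ∈ e.target) :
    ∃ V : Set E, IsOpen V ∧ u₀ ∈ V ∧ V ⊆ e.target ∧
      (∀ u ∈ V, ∀ h, HasDirDeriv (fun z => chartAt E (1 : G) ((e.symm u)⁻¹ * e.symm z)) u h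
        (leftLogDeriv e u h)) ∧ ∀ n, ParamCk V n (leftLogDeriv e) := by
  set e' := chartAt E (e.symm u₀)⁻¹
  have he' : e' ∈ atlas E G := chart_mem_atlas E _
  set V := e.target ∩ e.symm ⁻¹' ((fun g : G => g⁻¹) ⁻¹' e'.source)
  have hVo : IsOpen V := e.continuousOn_symm.isOpen_inter_preimage e.open_target
    (e'.open_source.preimage hG.smooth_inv.1)
  set i : E → E := fun u => e' (e.symm u)⁻¹
  have hi : ∀ u ∈ V, e'.symm (i u) = (e.symm u)⁻¹ := fun u hu => e'.left_inv hu.2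
  have hmem : ∀ u ∈ V, (i u, u) ∈ {u : E × E | u.1 ∈ e'.target ∧ u.2 ∈ e.target ∧
      e'.symm u.1 * e.symm u.2 ∈ (chartAt E (1 : G)).source} := by
    intro u hu
    refine ⟨e'.map_source hu.2, hu.1, ?_⟩
    simp [hi u hu]
  refine ⟨V, hVo, ⟨hu₀, mem_chart_source E _⟩, Set.inter_subset_left, fun u hu h => ?_,
    fun n => ?_⟩
  · have := (paramCk_mul_chart hG he' he (chart_mem_atlas E 1) 1).hasDirDeriv (hmem u hu)
      PUnit.unit (0, h)
    rw [dirDeriv_prod_zero, hasDirDeriv_prod_zero] at this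
    simp only [hi u hu] at this
    exact this
  · have h1 := (paramCk_mul_chart hG he' he (chart_mem_atlas E 1) (n + 1)).dirDeriv
    have hinv : ParamCk V n (fun u (_ : PUnit.{u + 1}) => i u) :=
      (smoothOnLC_iff_paramCk hVo).1 (hG.smooth_inv.2 e he e' he') n
    have hg : ParamCk V n (fun u (_ : PUnit.{u + 1}) => (i u, u)) :=
      hinv.prodMk hVo (paramCk_id hVo)
    have h2 := h1.comp hVo (isOpen_mul_chart_domain hG e' e _) hg hmem
    have h3 := h2.reindex (r := fun y : E => (PUnit.unit, ((0 : E), y))) (by fun_prop)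
    refine h3.congr hVo fun u hu h => ?_
    rw [dirDeriv_prod_zero]
    simp only [hi u hu]
    rfl

theorem paramCk_leftLogDeriv (hG : IsLCLieGroup E G) {e : OpenPartialHomeomorph G E}
    (he : e ∈ atlas E G) (n : ℕ) : ParamCk e.target n (leftLogDeriv e) := by
  refine ParamCk.of_locally fun u hu => ?_
  obtain ⟨V, hVo, huV, -, -, hV⟩ := exists_leftLogDeriv_chart hG he hu
  exact ⟨V, hVo, huV, hV n⟩

theorem hasDirDeriv_leftLogDeriv (hG : IsLCLieGroup E G) {e : OpenPartialHomeomorph G E}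
    (he : e ∈ atlas E G) {u : E} (hu : u ∈ e.target) (h : E) :
    HasDirDeriv (fun z => chartAt E (1 : G) ((e.symm u)⁻¹ * e.symm z)) u h
      (leftLogDeriv e u h) := by
  obtain ⟨V, -, huV, -, hV, -⟩ := exists_leftLogDeriv_chart hG he hu
  exact hV u huV h

theorem tendsto_symm_line {e : OpenPartialHomeomorph G E} {u : E} (hu : u ∈ e.target) (h : E) :
    ContinuousAt (fun s : ℝ => e.symm (u + s • h)) 0 := by
  have : ContinuousAt e.symm (u + (0 : ℝ) • h) := by
    rw [zero_smul, add_zero]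
    exact e.continuousOn_symm.continuousAt (e.open_target.mem_nhds hu)
  exact this.comp (f := fun s : ℝ => u + s • h) (by fun_prop)

/-- The derivative of an orbit map in a chart, in terms of the left logarithmic derivative. -/
theorem hasDirDeriv_orbit_chart (hG : IsLCLieGroup E G) {w : H}
    (hw : w ∈ smoothSubmodule E π) {e : OpenPartialHomeomorph G E} (he : e ∈ atlas E G) {u : E}
    (hu : u ∈ e.target) (h : E) :
    HasDirDeriv (fun z => (π (e.symm z) : H →L[ℂ] H) w) u h
      ((π (e.symm u) : H →L[ℂ] H) (orbitDeriv π w (leftLogDeriv e u h))) := by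
  -- Factoring the fixed operator π(e⁻¹(u)) out on the left reduces the derivative at `u` to one
  -- along a curve through the identity.
  have hc : ContinuousAt (fun s : ℝ => (e.symm u)⁻¹ * e.symm (u + s • h)) 0 :=
    hG.continuous_mul.continuousAt.comp (f := fun s : ℝ => ((e.symm u)⁻¹, e.symm (u + s • h)))
      (continuousAt_const.prodMk (tendsto_symm_line hu h))
  have hd := hasDirDeriv_iff_line.1 (hasDirDeriv_leftLogDeriv hG he hu h)
  have h1 := hasDerivAt_orbit_curve_one hw hc (by simp) hd
  have h2 := (hasDirDeriv_iff_hasDerivAt.2 h1).clm_comp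
    ((π (e.symm u) : H →L[ℂ] H).restrictScalars ℝ)
  rw [hasDirDeriv_iff_line]
  simp only [ContinuousLinearMap.coe_restrictScalars', ← unitaryRep_mul_apply,
    mul_inv_cancel_left] at h2
  exact h2

/-- Both sides differentiate the same curve, π applied to left translates of a chart line through 1:
once after pulling out the fixed operator, once in the chart `e`. The orbit map of a derived vector
is thereby expressed through the orbit map of `w`. -/
theorem unitaryRep_orbitDeriv (hG : IsLCLieGroup E G) {w : H}
    (hw : w ∈ smoothSubmodule E π) {e : OpenPartialHomeomorph G E} (he : e ∈ atlas E G) {u : E}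
    (hu : u ∈ e.target) (y : E) :
    (π (e.symm u) : H →L[ℂ] H) (orbitDeriv π w y) =
      dirDeriv (fun z => (π (e.symm z) : H →L[ℂ] H) w) u (mulVelocity e u y) := by
  have hφ : (chartAt E (1 : G)).symm (chartAt E (1 : G) 1) = 1 :=
    (chartAt E (1 : G)).left_inv (mem_chart_source E 1)
  have hc : ContinuousAt (fun s : ℝ =>
      e.symm u * (chartAt E (1 : G)).symm (chartAt E (1 : G) 1 + s • y)) 0 :=
    hG.continuous_mul.continuousAt.comp
      (f := fun s : ℝ => (e.symm u, (chartAt E (1 : G)).symm (chartAt E (1 : G) 1 + s • y)))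
      (continuousAt_const.prodMk (tendsto_symm_line (mem_chart_target E 1) y))
  have h0 : e.symm u * (chartAt E (1 : G)).symm (chartAt E (1 : G) 1 + (0 : ℝ) • y) =
      e.symm u := by simp [hφ]
  have hd := hasDirDeriv_iff_line.1 (hasDirDeriv_mulVelocity hG he hu y)
  have h1 := hasDerivAt_orbit_curve hw he hc (by rw [h0]; exact e.map_target hu) hd
  have hd' := hasDirDeriv_iff_line.1 (hasDirDeriv_orbitDeriv hw y)
  have h2 := hd'.clm_comp
    ((π (e.symm u) : H →L[ℂ] H).restrictScalars ℝ)
  simp only [ContinuousLinearMap.coe_restrictScalars', ← unitaryRep_mul_apply] at h2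
  rw [h0, e.right_inv hu] at h1
  exact (hasDirDeriv_iff_hasDerivAt.1 h2).unique h1

/-- Derivatives of a smooth family again form a smooth family. -/
theorem SmoothFamily.orbitDeriv (hG : IsLCLieGroup E G) {w : X → H} (hw : SmoothFamily E π w) :
    SmoothFamily E π (fun p : X × E => orbitDeriv π (w p.1) p.2) := by
  intro e he n
  -- The derivative of the orbit map is linear in its direction, so the velocity of left translation
  -- can be substituted there.
  have h1 := (hw e he (n + 1)).dirDeriv.linear_comp e.open_target (paramCk_mulVelocity hG he n)
    (fun u hu x z z' => (hw e he 1).dirDeriv_add e.open_target hu x z z')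
    (fun u hu x c z => (hw e he 1).dirDeriv_smul hu x c z)
  exact h1.congr e.open_target fun u hu p =>
    (unitaryRep_orbitDeriv hG (hw.mem p.1) he hu p.2).symm

end SmoothFamily

/-! ### The derived representation on smooth vectors -/

section DerivedRep

universe u

namespace Complexified

variable {E : Type*} [TopologicalSpace E]

theorem continuous_equivProd : Continuous (equivProd E) := continuous_induced_dom

@[fun_prop]
theorem continuous_re : Continuous (re : Complexified E → E) :=
  continuous_fst.comp continuous_equivProd

@[fun_prop]
theorem continuous_im : Continuous (im : Complexified E → E) :=
  continuous_snd.comp continuous_equivProd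

theorem continuous_iff {Y : Type*} [TopologicalSpace Y] {f : Y → Complexified E} :
    Continuous f ↔ Continuous (fun y => (f y).re) ∧ Continuous (fun y => (f y).im) :=
  continuous_induced_rng.trans continuous_prodMk

theorem re_real_smul {E : Type*} [AddCommGroup E] [Module ℝ E] (c : ℝ) (z : Complexified E) :
    (c • z).re = c • z.re := by
  -- The real scalar action is the restriction of the complex one.
  change ((c : ℂ) • z).re = _
  simp only [re_smul, Complex.ofReal_re, Complex.ofReal_im, zero_smul, sub_zero]

theorem im_real_smul {E : Type*} [AddCommGroup E] [Module ℝ E] (c : ℝ) (z : Complexified E) :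
    (c • z).im = c • z.im := by
  change ((c : ℂ) • z).im = _
  simp only [im_smul, Complex.ofReal_re, Complex.ofReal_im, zero_smul, add_zero]

end Complexified

variable {E : Type u} {G H : Type*} [AddCommGroup E] [Module ℝ E] [TopologicalSpace E]
  [IsTopologicalAddGroup E] [ContinuousSMul ℝ E] [LocallyConvexSpace ℝ E] [T2Space E]
  [TopologicalSpace G] [ChartedSpace E G] [Group G]
  [NormedAddCommGroup H] [InnerProductSpace ℂ H] [CompleteSpace H]
  {expG : E → G} {π : G →* unitary (H →L[ℂ] H)}

theorem IsSmoothExp.zero (hexp : IsSmoothExp expG) : expG 0 = 1 := by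
  simpa using hexp.add_smul 0 0 0

theorem IsSmoothExp.continuous_line (hexp : IsSmoothExp expG) (x : E) :
    Continuous fun s : ℝ => expG (s • x) :=
  hexp.smooth.1.comp (by fun_prop)

/-- The one-parameter group law transports the derivative at time 0 to time `s`. -/
theorem IsSmoothExp.hasDerivAt_orbit (hexp : IsSmoothExp expG) {w : H}
    (hw : w ∈ smoothSubmodule E π) (x : E) (s : ℝ) :
    HasDerivAt (fun r : ℝ => (π (expG (r • x)) : H →L[ℂ] H) w)
      ((π (expG (s • x)) : H →L[ℂ] H) (orbitDeriv π w x)) s := by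
  have h1 := hasDerivAt_orbit_curve_one hw (hexp.continuous_line x).continuousAt
    (by simp [hexp.zero]) (hexp.velocity x)
  have h2 := (hasDirDeriv_iff_hasDerivAt.2 h1).clm_comp
    ((π (expG (s • x)) : H →L[ℂ] H).restrictScalars ℝ)
  rw [← hasDirDeriv_iff_hasDerivAt, hasDirDeriv_iff_line]
  simpa only [ContinuousLinearMap.coe_restrictScalars', ← unitaryRep_mul_apply,
    ← hexp.add_smul, smul_eq_mul, mul_one] using h2

/-- The orbit derivative depends only on the velocity of the curve at 1. In this form linearity in
the Lie algebra element is the linearity of a derivative in its direction, which the exponential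
curves do not show. -/
theorem derivedRep_eq_orbitDeriv (hexp : IsSmoothExp expG) {w : H}
    (hw : w ∈ smoothSubmodule E π) (y : Complexified E) :
    derivedRep expG π y w = orbitDeriv π w y.re + Complex.I • orbitDeriv π w y.im := by
  have h := fun x => (hexp.hasDerivAt_orbit hw x 0).deriv
  simp only [zero_smul, hexp.zero, map_one, OneMemClass.coe_one,
    one_apply_eq_self] at h
  rw [derivedRep, h, h]

theorem derivedRep_add (hexp : IsSmoothExp expG) {w : H} (hw : w ∈ smoothSubmodule E π)
    (y z : Complexified E) :
    derivedRep expG π (y + z) w = derivedRep expG π y w + derivedRep expG π z w := by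
  simp only [derivedRep_eq_orbitDeriv hexp hw, Complexified.re_add, Complexified.im_add,
    orbitDeriv_add hw, smul_add]
  abel

theorem derivedRep_smul (hexp : IsSmoothExp expG) {w : H} (hw : w ∈ smoothSubmodule E π)
    (c : ℝ) (y : Complexified E) :
    derivedRep expG π (c • y) w = c • derivedRep expG π y w := by
  simp only [derivedRep_eq_orbitDeriv hexp hw, Complexified.re_real_smul,
    Complexified.im_real_smul, orbitDeriv_smul hw, smul_add]
  rw [smul_comm Complex.I c]

theorem derivedRep_add_vector (hexp : IsSmoothExp expG) {w w' : H}
    (hw : w ∈ smoothSubmodule E π) (hw' : w' ∈ smoothSubmodule E π) (y : Complexified E) :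
    derivedRep expG π y (w + w') = derivedRep expG π y w + derivedRep expG π y w' := by
  simp only [derivedRep_eq_orbitDeriv hexp hw, derivedRep_eq_orbitDeriv hexp hw',
    derivedRep_eq_orbitDeriv hexp (add_mem hw hw'), orbitDeriv_add_vector hw hw', smul_add]
  abel

theorem derivedRep_smul_vector (hexp : IsSmoothExp expG) {w : H}
    (hw : w ∈ smoothSubmodule E π) (c : ℂ) (y : Complexified E) :
    derivedRep expG π y (c • w) = c • derivedRep expG π y w := by
  simp only [derivedRep_eq_orbitDeriv hexp hw,
    derivedRep_eq_orbitDeriv hexp (Submodule.smul_mem _ c hw), orbitDeriv_smul_vector hw, smul_add]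
  rw [smul_comm Complex.I c]

theorem SmoothFamily.derivedRep (hG : IsLCLieGroup E G) (hexp : IsSmoothExp expG)
    {X : Type u} [TopologicalSpace X] {w : X → H} (hw : SmoothFamily E π w) :
    SmoothFamily E π (fun p : X × Complexified E => derivedRep expG π p.2 (w p.1)) := by
  have h := SmoothFamily.orbitDeriv hG hw
  have h1 := h.reindex (r := fun p : X × Complexified E => (p.1, p.2.re)) (by fun_prop)
  have h2 := h.reindex (r := fun p : X × Complexified E => (p.1, p.2.im)) (by fun_prop)
  have h3 := h1.add (h2.const_smul Complex.I)
  have : (fun p : X × Complexified E => _root_.derivedRep expG π p.2 (w p.1)) = fun p =>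
      _root_.orbitDeriv π (w p.1) p.2.re + Complex.I • _root_.orbitDeriv π (w p.1) p.2.im :=
    funext fun p => derivedRep_eq_orbitDeriv hexp (hw.mem p.1) p.2
  rw [this]
  exact h3

theorem derivedRep_mem (hG : IsLCLieGroup E G) (hexp : IsSmoothExp expG) {w : H}
    (hw : w ∈ smoothSubmodule E π) (y : Complexified E) :
    derivedRep expG π y w ∈ smoothSubmodule E π :=
  (SmoothFamily.derivedRep hG hexp hw).mem (PUnit.unit, y)

@[simp]
theorem derivedRepList_nil (v : H) : derivedRepList expG π [] v = v := rfl

@[simp]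
theorem derivedRepList_cons (y : Complexified E) (ys : List (Complexified E)) (v : H) :
    derivedRepList expG π (y :: ys) v = derivedRep expG π y (derivedRepList expG π ys v) := rfl

theorem derivedRepList_mem (hG : IsLCLieGroup E G) (hexp : IsSmoothExp expG) {v : H}
    (hv : v ∈ smoothSubmodule E π) (ys : List (Complexified E)) :
    derivedRepList expG π ys v ∈ smoothSubmodule E π := by
  induction ys with
  | nil => exact hv
  | cons y ys ih => exact derivedRep_mem hG hexp ih y

/-- Each application of dπ adds one parameter in 𝔤_ℂ to a smooth family; joint continuity in all
arguments is what makes a seminorm bound possible. -/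
theorem smoothFamily_derivedRepList (hG : IsLCLieGroup E G) (hexp : IsSmoothExp expG) {v : H}
    (hv : v ∈ smoothSubmodule E π) (k : ℕ) :
    SmoothFamily E π (fun y : Fin k → Complexified E =>
      derivedRepList expG π (List.ofFn y) v) := by
  induction k with
  | zero =>
    simpa using SmoothFamily.reindex hv (r := fun _ : Fin 0 → Complexified E => PUnit.unit)
      continuous_const
  | succ k ih =>
    have := (SmoothFamily.derivedRep hG hexp ih).reindex
      (r := fun y : Fin (k + 1) → Complexified E => (fun i : Fin k => y i.succ, y 0))
      (by fun_prop)
    simpa only [List.ofFn_succ, derivedRepList_cons] using this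

theorem derivedRepList_update_add (hG : IsLCLieGroup E G) (hexp : IsSmoothExp expG) {v : H}
    (hv : v ∈ smoothSubmodule E π) {k : ℕ} (y : Fin k → Complexified E) (i : Fin k)
    (a b : Complexified E) :
    derivedRepList expG π (List.ofFn (Function.update y i (a + b))) v =
      derivedRepList expG π (List.ofFn (Function.update y i a)) v +
        derivedRepList expG π (List.ofFn (Function.update y i b)) v := by
  induction k with
  | zero => exact i.elim0
  | succ k ih =>
    have hm := fun z : Fin k → Complexified E => derivedRepList_mem hG hexp hv (List.ofFn z)
    refine Fin.cases ?_ (fun i => ?_) i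
    · simp only [List.ofFn_succ, derivedRepList_cons, Function.update_self, ne_eq,
        Fin.succ_ne_zero, not_false_eq_true, Function.update_of_ne]
      exact derivedRep_add hexp (hm _) a b
    · have hu : ∀ z, (fun j : Fin k => Function.update y i.succ z j.succ) =
          Function.update (fun j : Fin k => y j.succ) i z := fun z =>
        Function.update_comp_eq_of_injective y (Fin.succ_injective k) i z
      simp only [List.ofFn_succ, derivedRepList_cons, hu, ne_eq, (Fin.succ_ne_zero i).symm,
        not_false_eq_true, Function.update_of_ne]
      rw [ih, derivedRep_add_vector hexp (hm _) (hm _)]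

theorem derivedRepList_update_smul (hG : IsLCLieGroup E G) (hexp : IsSmoothExp expG) {v : H}
    (hv : v ∈ smoothSubmodule E π) {k : ℕ} (y : Fin k → Complexified E) (i : Fin k)
    (c : ℝ) (a : Complexified E) :
    derivedRepList expG π (List.ofFn (Function.update y i (c • a))) v =
      c • derivedRepList expG π (List.ofFn (Function.update y i a)) v := by
  induction k with
  | zero => exact i.elim0
  | succ k ih =>
    have hm := fun z : Fin k → Complexified E => derivedRepList_mem hG hexp hv (List.ofFn z)
    refine Fin.cases ?_ (fun i => ?_) i
    · simp only [List.ofFn_succ, derivedRepList_cons, Function.update_self, ne_eq,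
        Fin.succ_ne_zero, not_false_eq_true, Function.update_of_ne]
      exact derivedRep_smul hexp (hm _) c a
    · have hu : ∀ z, (fun j : Fin k => Function.update y i.succ z j.succ) =
          Function.update (fun j : Fin k => y j.succ) i z := fun z =>
        Function.update_comp_eq_of_injective y (Fin.succ_injective k) i z
      simp only [List.ofFn_succ, derivedRepList_cons, hu, ne_eq, (Fin.succ_ne_zero i).symm,
        not_false_eq_true, Function.update_of_ne]
      rw [ih, ← Complex.coe_smul, derivedRep_smul_vector hexp (hm _), Complex.coe_smul]

/-- The map `(y₁, …, y_k) ↦ dπ(y₁) ⋯ dπ(y_k) v` as a multilinear map. -/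
noncomputable def derivedRepMultilinear (hG : IsLCLieGroup E G) (hexp : IsSmoothExp expG) {v : H}
    (hv : v ∈ smoothSubmodule E π) (k : ℕ) :
    MultilinearMap ℝ (fun _ : Fin k => Complexified E) H :=
  MultilinearMap.mk' (fun y => derivedRepList expG π (List.ofFn y) v)
    (fun y i a b => derivedRepList_update_add hG hexp hv y i a b)
    (fun y i c a => derivedRepList_update_smul hG hexp hv y i c a)

end DerivedRep

/-! ### Intertwining operators and growth bounds -/

section Intertwining

universe u

variable {E : Type u} {G H : Type*} [AddCommGroup E] [Module ℝ E] [TopologicalSpace E]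
  [IsTopologicalAddGroup E] [ContinuousSMul ℝ E] [LocallyConvexSpace ℝ E] [T2Space E]
  [TopologicalSpace G] [ChartedSpace E G] [Group G]
  [NormedAddCommGroup H] [InnerProductSpace ℂ H] [CompleteSpace H]
  {expG : E → G} {π : G →* unitary (H →L[ℂ] H)} {ψ : G → G} {L : H →L[ℂ] H}

theorem SmoothMapLC.exists_paramCk_chart (hψ : SmoothMapLC E E ψ)
    {e : OpenPartialHomeomorph G E} (he : e ∈ atlas E G) {u₀ : E} (hu₀ : u₀ ∈ e.target)
    {e' : OpenPartialHomeomorph G E} (he' : e' ∈ atlas E G) (h' : ψ (e.symm u₀) ∈ e'.source) :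
    ∃ V : Set E, IsOpen V ∧ u₀ ∈ V ∧ (∀ u ∈ V, ψ (e.symm u) ∈ e'.source) ∧
      ∀ n, ParamCk V n (fun u (_ : PUnit.{u + 1}) => e' (ψ (e.symm u))) := by
  have hVo : IsOpen (e.target ∩ e.symm ⁻¹' (ψ ⁻¹' e'.source)) :=
    e.continuousOn_symm.isOpen_inter_preimage e.open_target (e'.open_source.preimage hψ.1)
  exact ⟨_, hVo, ⟨hu₀, h'⟩, fun u hu => hu.2,
    (smoothOnLC_iff_paramCk hVo).1 (hψ.2 e he e' he')⟩

/-- The orbit map of `L w` is `L` after the orbit map of `w` after `ψ`. The case of interest is L =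
U_t and ψ = γ_{-t}. -/
theorem mem_smoothSubmodule_of_intertwining (hψ : SmoothMapLC E E ψ)
    (hL : ∀ g w, (π g : H →L[ℂ] H) (L w) = L ((π (ψ g) : H →L[ℂ] H) w)) {w : H}
    (hw : w ∈ smoothSubmodule E π) : L w ∈ smoothSubmodule E π := by
  intro e he n
  refine ParamCk.of_locally fun u₀ hu₀ => ?_
  obtain ⟨V, hVo, huV, hV, hC⟩ := hψ.exists_paramCk_chart he hu₀
    (chart_mem_atlas E (ψ (e.symm u₀))) (mem_chart_source E _)
  refine ⟨V, hVo, huV, ?_⟩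
  set e' := chartAt E (ψ (e.symm u₀))
  have h1 := ((hw e' (chart_mem_atlas E _) n).comp hVo e'.open_target (hC n)
    (fun u hu => e'.map_source (hV u hu))).clm_comp hVo (L.restrictScalars ℝ)
  refine h1.congr hVo fun u hu _ => ?_
  rw [e'.left_inv (hV u hu), hL]
  rfl

theorem exists_paramCk_chart_one (hψ : SmoothMapLC E E ψ) (hψ1 : ψ 1 = 1) :
    ∃ V : Set E, IsOpen V ∧ chartAt E (1 : G) 1 ∈ V ∧ ParamCk V 1 (fun u (_ : PUnit.{u + 1}) =>
      chartAt E (1 : G) (ψ ((chartAt E (1 : G)).symm u))) := by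
  obtain ⟨V, hVo, h1, -, hV⟩ := hψ.exists_paramCk_chart (chart_mem_atlas E (1 : G))
    (mem_chart_target E 1) (chart_mem_atlas E (1 : G))
    (by rw [(chartAt E (1 : G)).left_inv (mem_chart_source E 1), hψ1]
        exact mem_chart_source E 1)
  exact ⟨V, hVo, h1, hV 1⟩

theorem hasDirDeriv_lieDifferential (hψ : SmoothMapLC E E ψ) (hψ1 : ψ 1 = 1) (x : E) :
    HasDirDeriv (fun u => chartAt E (1 : G) (ψ ((chartAt E (1 : G)).symm u)))
      (chartAt E (1 : G) 1) x (lieDifferential ψ x) := by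
  obtain ⟨V, -, h1, hV⟩ := exists_paramCk_chart_one hψ hψ1
  exact hV.hasDirDeriv h1 PUnit.unit x

theorem lieDifferential_smul (hψ : SmoothMapLC E E ψ) (hψ1 : ψ 1 = 1) (c : ℝ) (x : E) :
    lieDifferential ψ (c • x) = c • lieDifferential ψ x := by
  obtain ⟨V, -, h1, hV⟩ := exists_paramCk_chart_one hψ hψ1
  exact hV.dirDeriv_smul h1 PUnit.unit c x

/-- A curve through 1 with velocity `x` is carried by `ψ` to one with velocity `lieDifferential ψ
x`. -/
theorem orbitDeriv_intertwining (hψ : SmoothMapLC E E ψ) (hψ1 : ψ 1 = 1)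
    (hL : ∀ g w, (π g : H →L[ℂ] H) (L w) = L ((π (ψ g) : H →L[ℂ] H) w)) {w : H}
    (hw : w ∈ smoothSubmodule E π) (x : E) :
    orbitDeriv π (L w) x = L (orbitDeriv π w (lieDifferential ψ x)) := by
  have hφ : (chartAt E (1 : G)).symm (chartAt E (1 : G) 1) = 1 :=
    (chartAt E (1 : G)).left_inv (mem_chart_source E 1)
  have hd := hasDirDeriv_iff_line.1 (hasDirDeriv_lieDifferential hψ hψ1 x)
  have hc : ContinuousAt (fun s : ℝ =>
      ψ ((chartAt E (1 : G)).symm (chartAt E (1 : G) 1 + s • x))) 0 :=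
    hψ.1.continuousAt.comp (tendsto_symm_line (mem_chart_target E 1) x)
  have h1 := hasDerivAt_orbit_curve_one hw hc (by simp [hφ, hψ1]) hd
  have h2 := (hasDirDeriv_iff_hasDerivAt.2 h1).clm_comp (L.restrictScalars ℝ)
  refine HasDirDeriv.dirDeriv_eq ?_
  rw [hasDirDeriv_iff_line]
  simp only [hL]
  exact h2

theorem derivedRep_intertwining (hexp : IsSmoothExp expG) (hψ : SmoothMapLC E E ψ)
    (hψ1 : ψ 1 = 1)
    (hL : ∀ g w, (π g : H →L[ℂ] H) (L w) = L ((π (ψ g) : H →L[ℂ] H) w)) {w : H}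
    (hw : w ∈ smoothSubmodule E π) (y : Complexified E) :
    derivedRep expG π y (L w) = L (derivedRep expG π (y.map (lieDifferential ψ)) w) := by
  rw [derivedRep_eq_orbitDeriv hexp (mem_smoothSubmodule_of_intertwining hψ hL hw),
    derivedRep_eq_orbitDeriv hexp hw, map_add, map_smul, orbitDeriv_intertwining hψ hψ1 hL hw,
    orbitDeriv_intertwining hψ hψ1 hL hw]
  rfl

theorem derivedRepList_intertwining (hG : IsLCLieGroup E G) (hexp : IsSmoothExp expG)
    (hψ : SmoothMapLC E E ψ) (hψ1 : ψ 1 = 1)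
    (hL : ∀ g w, (π g : H →L[ℂ] H) (L w) = L ((π (ψ g) : H →L[ℂ] H) w)) {v : H}
    (hv : v ∈ smoothSubmodule E π) (ys : List (Complexified E)) :
    derivedRepList expG π ys (L v) =
      L (derivedRepList expG π (ys.map (Complexified.map (lieDifferential ψ))) v) := by
  induction ys with
  | nil => rfl
  | cons y ys ih =>
    rw [derivedRepList_cons, ih, derivedRep_intertwining hexp hψ hψ1 hL
      (derivedRepList_mem hG hexp hv _), List.map_cons, derivedRepList_cons]

end Intertwining

/-! ### The complexification as a locally convex space. -/

section Complexified

variable {E : Type*} [AddCommGroup E] [Module ℝ E] [TopologicalSpace E]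

instance [IsTopologicalAddGroup E] : IsTopologicalAddGroup (Complexified E) where
  continuous_add := by
    rw [Complexified.continuous_iff]
    simp only [Complexified.re_add, Complexified.im_add]
    constructor <;> fun_prop
  continuous_neg := by
    rw [Complexified.continuous_iff]
    exact ⟨Complexified.continuous_re.neg, Complexified.continuous_im.neg⟩

instance [IsTopologicalAddGroup E] [ContinuousSMul ℝ E] : ContinuousSMul ℂ (Complexified E) where
  continuous_smul := by
    rw [Complexified.continuous_iff]
    simp only [Complexified.re_smul, Complexified.im_smul]
    constructor <;> fun_prop

instance [IsTopologicalAddGroup E] [ContinuousSMul ℝ E] : ContinuousSMul ℝ (Complexified E) :=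
  IsScalarTower.continuousSMul ℂ

instance [LocallyConvexSpace ℝ E] [IsTopologicalAddGroup E] [ContinuousSMul ℝ E] :
    LocallyConvexSpace ℝ (Complexified E) :=
  LocallyConvexSpace.induced (t := inferInstance)
    ({ toFun := Complexified.equivProd E
       map_add' := fun _ _ => rfl
       map_smul' := fun c z => Prod.ext (Complexified.re_real_smul c z)
        (Complexified.im_real_smul c z) } : Complexified E →ₗ[ℝ] E × E)

end Complexified

/-! ### Seminorm bounds for multilinear maps and the growth of α. -/

section Seminorm

variable {V : Type*} [AddCommGroup V] [Module ℂ V] [TopologicalSpace V]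

open scoped ComplexOrder in
-- The seminorm is the gauge of an absolutely convex open set inside `W`. It must be complex
-- homogeneous because polynomial boundedness is tested on complex seminorms.
theorem exists_seminorm_lt_one_subset [IsTopologicalAddGroup V] [ContinuousSMul ℂ V]
    [LocallyConvexSpace ℝ V] {W : Set V} (hW : W ∈ 𝓝 (0 : V)) :
    ∃ p : Seminorm ℂ V, Continuous p ∧ ∀ x, p x < 1 → x ∈ W := by
  have : ContinuousSMul ℝ V := IsScalarTower.continuousSMul ℂ
  -- For the partial order on ℂ, convexity over ℂ and over ℝ coincide.
  have : LocallyConvexSpace ℂ V := ⟨fun x => by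
    simpa only [convex_RCLike_iff_convex_real (K := ℂ)] using
      LocallyConvexSpace.convex_basis (𝕜 := ℝ) x⟩
  obtain ⟨s, ⟨h0, ho, hs⟩, hsW⟩ := (nhds_hasBasis_absConvex_open ℂ V).mem_iff.1 hW
  let s' : AbsConvexOpenSets ℂ V := ⟨s, h0, ho, hs⟩
  refine ⟨gaugeSeminormFamily ℂ V s', with_gaugeSeminormFamily.continuous_seminorm s',
    fun x hx => hsW ?_⟩
  have := gaugeSeminormFamily_ball s'
  rw [Seminorm.ball_zero_eq] at this
  exact this.subset hx

theorem Seminorm.map_real_smul (p : Seminorm ℂ V) (c : ℝ) (x : V) : p (c • x) = |c| * p x := by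
  rw [← Complex.coe_smul, map_smul_eq_mul, Complex.norm_real, Real.norm_eq_abs]

/-- Scaling by the inverse of q(x) + ε moves `x` into the unit ball even when q(x) = 0; then ε → 0.
-/
theorem Seminorm.comp_le_of_forall_lt_one (p q : Seminorm ℂ V) {T : V → V}
    (hT : ∀ (c : ℝ) x, T (c • x) = c • T x) {C : ℝ} (h : ∀ x, q x < 1 → p (T x) ≤ C) (x : V) :
    p (T x) ≤ C * q x := by
  have key : ∀ ε : ℝ, 0 < ε → p (T x) ≤ C * (q x + ε) := by
    intro ε hε
    have hr : 0 < q x + ε := add_pos_of_nonneg_of_pos (apply_nonneg q x) hε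
    have h1 := h ((q x + ε)⁻¹ • x) (by
      rw [q.map_real_smul, abs_of_pos (inv_pos.2 hr), inv_mul_lt_one₀ hr]
      linarith)
    rw [hT, p.map_real_smul, abs_of_pos (inv_pos.2 hr), inv_mul_le_iff₀ hr] at h1
    linarith
  have hlim : Tendsto (fun ε : ℝ => C * (q x + ε)) (𝓝[>] 0) (𝓝 (C * (q x + 0))) :=
    (Continuous.tendsto (by fun_prop) 0).mono_left nhdsWithin_le_nhds
  rw [add_zero] at hlim
  refine ge_of_tendsto hlim ?_
  filter_upwards [self_mem_nhdsWithin] with ε hε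
  exact key ε hε

variable {H : Type*} [NormedAddCommGroup H] [NormedSpace ℝ H] {k : ℕ}

/-- Continuity at 0 bounds `M` on a product of seminorm balls. Each argument is scaled into the ball
by the inverse of p(y_i) + ε, and ε → 0. -/
theorem MultilinearMap.exists_seminorm_bound [IsTopologicalAddGroup V] [ContinuousSMul ℂ V]
    [LocallyConvexSpace ℝ V] (M : MultilinearMap ℝ (fun _ : Fin k => V) H) (hM : Continuous M) :
    ∃ (C : ℝ) (p : Seminorm ℂ V), 0 ≤ C ∧ Continuous p ∧ ∀ y, ‖M y‖ ≤ C * ∏ i, p (y i) := by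
  -- For k > 0 the term ‖M 0‖ vanishes; for k = 0 it is needed, since `M` is then an arbitrary
  -- constant and the product is empty.
  have hN : {y | ‖M y‖ < ‖M 0‖ + 1} ∈ 𝓝 (0 : Fin k → V) :=
    (isOpen_lt hM.norm continuous_const).mem_nhds (by simp)
  rw [nhds_pi, Filter.mem_pi'] at hN
  obtain ⟨I, t, ht, hsub⟩ := hN
  obtain ⟨p, hp, hpW⟩ := exists_seminorm_lt_one_subset
    (W := ⋂ i, t i) ((Filter.iInter_mem).2 fun i => ht i)
  have hC : 0 ≤ ‖M 0‖ + 1 := by positivity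
  refine ⟨‖M 0‖ + 1, p, hC, hp, fun y => ?_⟩
  have key : ∀ ε : ℝ, 0 < ε → ‖M y‖ ≤ (‖M 0‖ + 1) * ∏ i, (p (y i) + ε) := by
    intro ε hε
    have hr : ∀ i, 0 < p (y i) + ε := fun i => add_pos_of_nonneg_of_pos (apply_nonneg p _) hε
    have hy : y = fun i => (p (y i) + ε) • ((p (y i) + ε)⁻¹ • y i) := by
      funext i
      rw [smul_smul, mul_inv_cancel₀ (hr i).ne', one_smul]
    have h1 : ‖M (fun i => (p (y i) + ε)⁻¹ • y i)‖ < ‖M 0‖ + 1 := by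
      refine hsub fun i _ => Set.mem_iInter.1 (hpW _ ?_) i
      rw [p.map_real_smul, abs_of_pos (inv_pos.2 (hr i)), inv_mul_lt_one₀ (hr i)]
      linarith
    have hpos : 0 ≤ ∏ i, (p (y i) + ε) := Finset.prod_nonneg fun i _ => (hr i).le
    rw [hy, M.map_smul_univ, ← hy, norm_smul, Real.norm_of_nonneg hpos, mul_comm]
    exact mul_le_mul_of_nonneg_right h1.le hpos
  have hlim : Tendsto (fun ε : ℝ => (‖M 0‖ + 1) * ∏ i, (p (y i) + ε)) (𝓝[>] 0)
      (𝓝 ((‖M 0‖ + 1) * ∏ i, (p (y i) + 0))) :=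
    (Continuous.tendsto (by fun_prop) 0).mono_left nhdsWithin_le_nhds
  simp only [add_zero] at hlim
  refine ge_of_tendsto hlim ?_
  filter_upwards [self_mem_nhdsWithin] with ε hε
  exact key ε hε

/-- Expanding M(y + (z - y)) over subsets of the arguments, every term except M(y) carries a factor
p(z_i - y_i), which tends to 0. -/
theorem MultilinearMap.continuous_of_seminorm_bound [IsTopologicalAddGroup V]
    (M : MultilinearMap ℝ (fun _ : Fin k => V) H) {C : ℝ} {p : Seminorm ℂ V} (hp : Continuous p)
    (hM : ∀ y, ‖M y‖ ≤ C * ∏ i, p (y i)) : Continuous M := by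
  rw [continuous_iff_continuousAt]
  intro y
  have hsum : ∀ z, M z = ∑ s : Finset (Fin k), M (s.piecewise y (z - y)) := by
    intro z
    rw [← M.map_add_univ, add_sub_cancel]
  have hlim : Tendsto (fun z => ∑ s : Finset (Fin k), M (s.piecewise y (z - y))) (𝓝 y)
      (𝓝 (∑ s : Finset (Fin k), if s = Finset.univ then M y else 0)) := by
    refine tendsto_finsetSum _ fun s _ => ?_
    split_ifs with hs
    · subst hs
      simp only [Finset.piecewise_univ]
      exact tendsto_const_nhds
    · obtain ⟨i, hi⟩ : ∃ i, i ∉ s := by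
        by_contra! hall
        exact hs (Finset.eq_univ_iff_forall.2 hall)
      refine squeeze_zero_norm (fun z => hM _) ?_
      have hc : Continuous (fun z : Fin k → V =>
          C * ∏ i, p (s.piecewise y (z - y) i)) := by
        refine continuous_const.mul (continuous_finsetProd _ fun j _ => hp.comp ?_)
        by_cases hj : j ∈ s
        · simpa [hj] using continuous_const
        · simp only [Finset.piecewise_eq_of_notMem _ _ _ hj, Pi.sub_apply]
          fun_prop
      have h0 : C * ∏ i, p (s.piecewise y (y - y) i) = 0 := by
        rw [Finset.prod_eq_zero (Finset.mem_univ i), mul_zero]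
        simp [hi]
      have := hc.tendsto y
      rwa [h0] at this
  simp only [Finset.sum_ite_eq', Finset.mem_univ, if_true] at hlim
  exact hlim.congr fun z => (hsum z).symm

/-- Both hypotheses on `(α, f)` give weights that make `f` times all powers integrable. -/
theorem exists_weight_bound [IsTopologicalAddGroup V] [ContinuousSMul ℂ V]
    [LocallyConvexSpace ℝ V] {α : ℝ → V → V} (hα : ∀ t (c : ℝ) x, α t (c • x) = c • α t x)
    {f : ℝ → ℂ} (hf : (EquicontFamily α ∧ Integrable f) ∨
      (PolyBounded α ∧ ∃ φ : 𝓢(ℝ, ℂ), ∀ t : ℝ, φ t = f t))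
    {p : Seminorm ℂ V} (hp : Continuous p) :
    ∃ (m : ℝ → ℝ) (q : Seminorm ℂ V), Continuous q ∧ (∀ t, 0 ≤ m t) ∧
      (∀ k : ℕ, Integrable (fun t => ‖f t‖ * m t ^ k)) ∧
      ∀ t x, p (α (-t) x) ≤ m t * q x := by
  rcases hf with ⟨hα', hf⟩ | ⟨hα', φ, hφ⟩
  · obtain ⟨W, hW, hWp⟩ := hα' {x | p x < 1} (isOpen_lt hp continuous_const) (by simp)
    obtain ⟨q, hq, hqW⟩ := exists_seminorm_lt_one_subset hW
    refine ⟨fun _ => 1, q, hq, fun _ => zero_le_one, fun k => by simpa using hf.norm,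
      fun t x => p.comp_le_of_forall_lt_one q (hα (-t)) (fun z hz => ?_) x⟩
    exact (hWp (-t) z (hqW z hz)).le
  · obtain ⟨N, hN⟩ := hα' p hp
    obtain ⟨W, hW, hWp⟩ := hN 1 one_pos
    obtain ⟨q, hq, hqW⟩ := exists_seminorm_lt_one_subset hW
    have hpos : ∀ t : ℝ, 0 < 1 + |t| ^ N := fun t => by positivity
    -- The weight is the normalizing factor of polynomial boundedness, unchanged under t ↦ -t. Its
    -- powers expand binomially into powers of |t|, which are integrable against a Schwartz
    -- function.
    refine ⟨fun t => 1 + |t| ^ N, q, hq, fun t => (hpos t).le, fun k => ?_,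
      fun t x => p.comp_le_of_forall_lt_one q (hα (-t)) (fun z hz => ?_) x⟩
    · have : (fun t => ‖f t‖ * (1 + |t| ^ N) ^ k) = fun t =>
          ∑ j ∈ Finset.range (k + 1), (k.choose j : ℝ) * (‖t‖ ^ (N * j) * ‖φ t‖) := by
        funext t
        rw [add_comm, add_pow, Finset.mul_sum]
        refine Finset.sum_congr rfl fun j _ => ?_
        rw [hφ, one_pow, ← pow_mul, Real.norm_eq_abs]
        ring
      rw [this]
      exact integrable_finsetSum _ fun j _ => (φ.integrable_pow_mul volume (N * j)).const_mul _
    · have := hWp (-t) z (hqW z hz)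
      rw [abs_neg, map_smul_eq_mul, Complex.norm_real, Real.norm_of_nonneg (inv_pos.2 (hpos t)).le,
        inv_mul_lt_one₀ (hpos t)] at this
      exact this.le

end Seminorm

/-! ### Integrals of families of smooth vectors -/

section Integral

universe u

variable {E : Type u} {G H : Type*} [AddCommGroup E] [Module ℝ E] [TopologicalSpace E]
  [IsTopologicalAddGroup E] [ContinuousSMul ℝ E] [LocallyConvexSpace ℝ E] [T2Space E]
  [TopologicalSpace G] [ChartedSpace E G] [Group G]
  [NormedAddCommGroup H] [InnerProductSpace ℂ H] [CompleteSpace H]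
  {expG : E → G} {π : G →* unitary (H →L[ℂ] H)}

/-- The inclusion `E → E_ℂ`. -/
def Complexified.ofReal (x : E) : Complexified E := ⟨x, 0⟩

theorem Complexified.continuous_ofReal :
    Continuous (Complexified.ofReal : E → Complexified E) := by
  rw [Complexified.continuous_iff]
  exact ⟨continuous_id, continuous_const⟩

theorem Complexified.ofReal_add (x y : E) :
    Complexified.ofReal (x + y) = Complexified.ofReal x + Complexified.ofReal y := by
  ext <;> simp [Complexified.ofReal]

theorem Complexified.ofReal_smul (c : ℝ) (x : E) :
    Complexified.ofReal (c • x) = c • Complexified.ofReal x := by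
  ext
  · rw [Complexified.re_real_smul]
    rfl
  · rw [Complexified.im_real_smul]
    simp [Complexified.ofReal]

theorem derivedRep_ofReal (hexp : IsSmoothExp expG) {w : H} (hw : w ∈ smoothSubmodule E π)
    (x : E) : derivedRep expG π (Complexified.ofReal x) w = orbitDeriv π w x := by
  have h0 : orbitDeriv π w (0 : E) = 0 := by simpa using orbitDeriv_smul hw 0 (0 : E)
  rw [derivedRep_eq_orbitDeriv hexp hw]
  simp [Complexified.ofReal, h0]

/-- The derivative is a pointwise limit of difference quotients along a sequence, and each quotient
applies fixed bounded operators to `w t`. No continuity in t of the derived vectors is required. -/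
theorem stronglyMeasurable_orbitDeriv (hexp : IsSmoothExp expG) {w : ℝ → H}
    (hw : ∀ t, w t ∈ smoothSubmodule E π) (hm : StronglyMeasurable w) (x : E) :
    StronglyMeasurable (fun t => orbitDeriv π (w t) x) := by
  let s : ℕ → ℝ := fun n => 1 / ((n : ℝ) + 1)
  have hs : Tendsto s atTop (𝓝[≠] 0) :=
    tendsto_nhdsWithin_of_tendsto_nhds_of_eventually_within _
      tendsto_one_div_add_atTop_nhds_zero_nat
      (Eventually.of_forall fun n => (Nat.one_div_pos_of_nat (α := ℝ)).ne')
  refine stronglyMeasurable_of_tendsto atTop (f := fun n t =>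
    (s n)⁻¹ • ((π (expG (s n • x)) : H →L[ℂ] H) (w t) - w t)) (fun n => ?_) ?_
  · exact (((π (expG (s n • x)) : H →L[ℂ] H).continuous.comp_stronglyMeasurable hm).sub
      hm).const_smul _
  · rw [tendsto_pi_nhds]
    intro t
    have h1 := ((hasDerivAt_iff_tendsto_slope_zero.1
      (hexp.hasDerivAt_orbit (hw t) x 0)).comp hs)
    simpa [Function.comp_def, hexp.zero] using h1

theorem stronglyMeasurable_derivedRepList (hG : IsLCLieGroup E G) (hexp : IsSmoothExp expG)
    {v : ℝ → H} (hv : ∀ t, v t ∈ smoothSubmodule E π) (hm : StronglyMeasurable v)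
    (ys : List (Complexified E)) :
    StronglyMeasurable (fun t => derivedRepList expG π ys (v t)) := by
  induction ys with
  | nil => exact hm
  | cons y ys ih =>
    have hmem := fun t => derivedRepList_mem hG hexp (hv t) ys
    simp only [derivedRepList_cons, derivedRep_eq_orbitDeriv hexp (hmem _)]
    exact (stronglyMeasurable_orbitDeriv hexp hmem ih _).add
      ((stronglyMeasurable_orbitDeriv hexp hmem ih _).const_smul _)

/-- A family of smooth vectors `v t` with a scalar weight `f` for which the vectors
`dπ(y₁) ⋯ dπ(y_k) v t` have seminorm bounds that are integrable against `f`. -/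
structure DominatedFamily (expG : E → G) (π : G →* unitary (H →L[ℂ] H)) (f : ℝ → ℂ)
    (v : ℝ → H) : Prop where
  mem : ∀ t, v t ∈ smoothSubmodule E π
  stronglyMeasurable : StronglyMeasurable v
  aestronglyMeasurable : AEStronglyMeasurable f
  bound : ∀ k : ℕ, ∃ (m : ℝ → ℝ) (q : Seminorm ℂ (Complexified E)), Continuous q ∧
    (∀ t, 0 ≤ m t) ∧ Integrable (fun t => ‖f t‖ * m t) ∧
    ∀ t (y : Fin k → Complexified E),
      ‖derivedRepList expG π (List.ofFn y) (v t)‖ ≤ m t * ∏ i, q (y i)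

namespace DominatedFamily

variable {f : ℝ → ℂ} {v : ℝ → H}

theorem integrable (hG : IsLCLieGroup E G) (hexp : IsSmoothExp expG)
    (hv : DominatedFamily expG π f v) (ys : List (Complexified E)) :
    Integrable (fun t => f t • derivedRepList expG π ys (v t)) := by
  obtain ⟨m, q, -, -, hmi, hb⟩ := hv.bound ys.length
  refine (hmi.mul_const (∏ i, q (ys.get i))).mono' (hv.aestronglyMeasurable.smul
    (stronglyMeasurable_derivedRepList hG hexp hv.mem
      hv.stronglyMeasurable ys).aestronglyMeasurable) (Eventually.of_forall fun t => ?_)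
  have := hb t ys.get
  rw [List.ofFn_get] at this
  rw [norm_smul, mul_assoc]
  exact mul_le_mul_of_nonneg_left this (norm_nonneg _)

variable (expG π f v) in
/-- The integral of `f t • dπ(y₁) ⋯ dπ(y_k) v t`. -/
noncomputable def integral (ys : List (Complexified E)) : H :=
  ∫ t, f t • derivedRepList expG π ys (v t)

/-- Differentiation under the integral sign along a curve in `G`. -/
theorem hasDerivAt_integral (hG : IsLCLieGroup E G) (hexp : IsSmoothExp expG)
    (hv : DominatedFamily expG π f v) {c : ℝ → G} {x : ℝ → E} (hx : ContinuousAt x 0)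
    (hc : ∀ᶠ s in 𝓝 0, ∀ w ∈ smoothSubmodule E π,
      HasDerivAt (fun r => (π (c r) : H →L[ℂ] H) w)
        ((π (c s) : H →L[ℂ] H) (orbitDeriv π w (x s))) s) (ys : List (Complexified E)) :
    HasDerivAt (fun s => (π (c s) : H →L[ℂ] H) (integral expG π f v ys))
      ((π (c 0) : H →L[ℂ] H) (integral expG π f v (Complexified.ofReal (x 0) :: ys))) 0 := by
  have hmem := fun t => derivedRepList_mem hG hexp (hv.mem t) ys
  have hcomm : ∀ s zs, (π (c s) : H →L[ℂ] H) (integral expG π f v zs) =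
      ∫ t, f t • (π (c s) : H →L[ℂ] H) (derivedRepList expG π zs (v t)) := by
    intro s zs
    rw [integral, ← ContinuousLinearMap.integral_comp_comm _ (hv.integrable hG hexp zs)]
    simp only [map_smul]
  have hmeas : ∀ s zs, AEStronglyMeasurable
      (fun t => f t • (π (c s) : H →L[ℂ] H) (derivedRepList expG π zs (v t))) := fun s zs =>
    hv.aestronglyMeasurable.smul ((π (c s) : H →L[ℂ] H).continuous.comp_aestronglyMeasurable
      (stronglyMeasurable_derivedRepList hG hexp hv.mem hv.stronglyMeasurable
        zs).aestronglyMeasurable)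
  -- The derivative has the extra argument `x s`. Continuity of `x` at 0 keeps its seminorm below
  -- `Q` for small s, and unitarity removes π(c s), so ‖f‖ m Q P dominates.
  obtain ⟨m, q, hq, hm0, hmi, hb⟩ := hv.bound (ys.length + 1)
  set Q := q (Complexified.ofReal (x 0)) + 1
  set P := ∏ i, q (ys.get i)
  have hP : 0 ≤ P := Finset.prod_nonneg fun i _ => apply_nonneg q _
  have hqx : ∀ᶠ s in 𝓝 0, q (Complexified.ofReal (x s)) < Q :=
    ((hq.comp Complexified.continuous_ofReal).continuousAt.comp hx).eventually
      (gt_mem_nhds (lt_add_one _))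
  have key := hasDerivAt_integral_of_dominated_loc_of_deriv_le (μ := volume) (𝕜 := ℝ)
    (F := fun s t => f t • (π (c s) : H →L[ℂ] H) (derivedRepList expG π ys (v t)))
    (F' := fun s t => f t • (π (c s) : H →L[ℂ] H)
      (orbitDeriv π (derivedRepList expG π ys (v t)) (x s)))
    (bound := fun t => ‖f t‖ * m t * (Q * P)) (hc.and hqx)
    (Eventually.of_forall fun s => hmeas s ys) ?_ ?_ ?_ (hmi.mul_const _) ?_
  · have h2 := key.2
    simp only [← hcomm] at h2
    refine h2.congr_deriv ?_
    rw [hcomm]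
    simp only [derivedRepList_cons, derivedRep_ofReal hexp (hmem _)]
  · have := (π (c 0) : H →L[ℂ] H).integrable_comp (hv.integrable hG hexp ys)
    simpa only [map_smul] using this
  · have := hmeas 0 (Complexified.ofReal (x 0) :: ys)
    simpa only [derivedRepList_cons, derivedRep_ofReal hexp (hmem _)] using this
  · refine Eventually.of_forall fun t s hs => ?_
    have h1 := hb t (Fin.cons (Complexified.ofReal (x s)) ys.get)
    rw [List.ofFn_cons, List.ofFn_get, derivedRepList_cons, derivedRep_ofReal hexp (hmem t),
      Fin.prod_univ_succ] at h1
    simp only [Fin.cons_zero, Fin.cons_succ] at h1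
    rw [norm_smul, unitaryRep_norm_apply, mul_assoc]
    refine mul_le_mul_of_nonneg_left (h1.trans (mul_le_mul_of_nonneg_left ?_ (hm0 t)))
      (norm_nonneg _)
    exact mul_le_mul_of_nonneg_right hs.2.le hP
  · refine Eventually.of_forall fun t s hs => ?_
    exact (hs.1 _ (hmem t)).const_smul (f t)

/-- Exponential curves give the two real directions; the integral is complex linear, so they combine
into the complex direction. -/
theorem derivedRep_integral (hG : IsLCLieGroup E G) (hexp : IsSmoothExp expG)
    (hv : DominatedFamily expG π f v) (y : Complexified E) (ys : List (Complexified E)) :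
    derivedRep expG π y (integral expG π f v ys) = integral expG π f v (y :: ys) := by
  have hmem := fun t => derivedRepList_mem hG hexp (hv.mem t) ys
  have hd : ∀ x : E, deriv (fun s : ℝ => (π (expG (s • x)) : H →L[ℂ] H)
      (integral expG π f v ys)) 0 = integral expG π f v (Complexified.ofReal x :: ys) := by
    intro x
    have := hv.hasDerivAt_integral hG hexp (c := fun s => expG (s • x)) (x := fun _ => x)
      continuousAt_const (Eventually.of_forall fun s w hw => hexp.hasDerivAt_orbit hw x s) ys
    simpa [hexp.zero] using this.deriv
  have hi : ∀ x : E, Integrable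
      (fun t => f t • orbitDeriv π (derivedRepList expG π ys (v t)) x) := by
    intro x
    simpa only [derivedRepList_cons, derivedRep_ofReal hexp (hmem _)] using
      hv.integrable hG hexp (Complexified.ofReal x :: ys)
  rw [derivedRep, hd, hd]
  simp only [integral, derivedRepList_cons, derivedRep_ofReal hexp (hmem _),
    derivedRep_eq_orbitDeriv hexp (hmem _), smul_add]
  rw [← MeasureTheory.integral_smul]
  refine (integral_add (hi _) ((hi _).smul Complex.I)).symm.trans ?_
  simp only [Pi.smul_apply, smul_comm Complex.I]

theorem derivedRepList_integral (hG : IsLCLieGroup E G) (hexp : IsSmoothExp expG)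
    (hv : DominatedFamily expG π f v) (ys : List (Complexified E)) :
    derivedRepList expG π ys (integral expG π f v []) = integral expG π f v ys := by
  induction ys with
  | nil => rfl
  | cons y ys ih => rw [derivedRepList_cons, ih, hv.derivedRep_integral hG hexp]

/-- `integral` as a multilinear map. -/
noncomputable def integralMultilinear (hG : IsLCLieGroup E G) (hexp : IsSmoothExp expG)
    (hv : DominatedFamily expG π f v) (k : ℕ) :
    MultilinearMap ℝ (fun _ : Fin k => Complexified E) H :=
  MultilinearMap.mk' (fun y => integral expG π f v (List.ofFn y))
    (fun y i a b => by
      simp only [integral, derivedRepList_update_add hG hexp (hv.mem _), smul_add]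
      exact integral_add (hv.integrable hG hexp _) (hv.integrable hG hexp _))
    (fun y i c a => by
      simp only [integral, derivedRepList_update_smul hG hexp (hv.mem _)]
      rw [← MeasureTheory.integral_smul]
      simp only [smul_comm c])

theorem integralMultilinear_apply (hG : IsLCLieGroup E G) (hexp : IsSmoothExp expG)
    (hv : DominatedFamily expG π f v) {k : ℕ} (y : Fin k → Complexified E) :
    hv.integralMultilinear hG hexp k y = integral expG π f v (List.ofFn y) :=
  rfl

/-- Integrating the dominating bound leaves a seminorm bound with constant ∫ ‖f‖ m. -/
theorem continuous_integralMultilinear (hG : IsLCLieGroup E G) (hexp : IsSmoothExp expG)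
    (hv : DominatedFamily expG π f v) (k : ℕ) :
    Continuous (hv.integralMultilinear hG hexp k) := by
  obtain ⟨m, q, hq, -, hmi, hb⟩ := hv.bound k
  refine MultilinearMap.continuous_of_seminorm_bound _ hq (C := ∫ t, ‖f t‖ * m t) fun y => ?_
  rw [integralMultilinear_apply, integral, ← MeasureTheory.integral_mul_const]
  refine norm_integral_le_of_norm_le (hmi.mul_const _) (Eventually.of_forall fun t => ?_)
  rw [norm_smul, mul_assoc]
  exact mul_le_mul_of_nonneg_left (hb t y) (norm_nonneg _)

/-- Since the operators are isometric, strong continuity upgrades to joint continuity. -/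
theorem continuous_unitaryRep_apply (hπ : ∀ v : H, Continuous fun g => (π g : H →L[ℂ] H) v) :
    Continuous (fun p : G × H => (π p.1 : H →L[ℂ] H) p.2) := by
  rw [continuous_iff_continuousAt]
  rintro ⟨g, w⟩
  rw [ContinuousAt, tendsto_iff_norm_sub_tendsto_zero]
  have hlim : Tendsto (fun p : G × H => ‖p.2 - w‖ +
      ‖(π p.1 : H →L[ℂ] H) w - (π g : H →L[ℂ] H) w‖) (𝓝 (g, w)) (𝓝 0) := by
    have hc : Continuous (fun p : G × H => ‖p.2 - w‖ +
        ‖(π p.1 : H →L[ℂ] H) w - (π g : H →L[ℂ] H) w‖) :=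
      ((continuous_snd.sub continuous_const).norm).add
        ((((hπ w).comp continuous_fst).sub continuous_const).norm)
    simpa using hc.tendsto (g, w)
  refine squeeze_zero (fun _ => norm_nonneg _) (fun p => ?_) hlim
  calc ‖(π p.1 : H →L[ℂ] H) p.2 - (π g : H →L[ℂ] H) w‖
      = ‖(π p.1 : H →L[ℂ] H) (p.2 - w) +
          ((π p.1 : H →L[ℂ] H) w - (π g : H →L[ℂ] H) w)‖ := by
        rw [map_sub, sub_add_sub_cancel]
    _ ≤ _ := (norm_add_le _ _).trans_eq (by rw [unitaryRep_norm_apply])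

/-- Differentiating in the chart inserts the left logarithmic derivative as a new first argument of
the integral. The derivative is thus the case k + 1 with a smooth map substituted into a linear
slot, which is why the induction on `n` keeps k free. -/
theorem paramCk_integral (hG : IsLCLieGroup E G) (hexp : IsSmoothExp expG)
    (hπ : ∀ v : H, Continuous fun g => (π g : H →L[ℂ] H) v)
    (hv : DominatedFamily expG π f v) {e : OpenPartialHomeomorph G E} (he : e ∈ atlas E G)
    (n k : ℕ) : ParamCk e.target n (fun u (y : Fin k → Complexified E) =>
      (π (e.symm u) : H →L[ℂ] H) (integral expG π f v (List.ofFn y))) := by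
  have hcont : ∀ k, ContinuousOn (fun p : E × (Fin k → Complexified E) =>
      (π (e.symm p.1) : H →L[ℂ] H) (integral expG π f v (List.ofFn p.2)))
      (e.target ×ˢ Set.univ) := by
    intro k
    refine (continuous_unitaryRep_apply hπ).comp_continuousOn
      (f := fun p : E × (Fin k → Complexified E) =>
        (e.symm p.1, integral expG π f v (List.ofFn p.2))) (ContinuousOn.prodMk ?_ ?_)
    · exact e.continuousOn_symm.comp continuousOn_fst fun _ hp => hp.1
    · exact ((hv.continuous_integralMultilinear hG hexp k).comp continuous_snd).continuousOn
  induction n generalizing k with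
  | zero => exact paramCk_zero_iff.2 (hcont k)
  | succ n ih =>
    refine ParamCk.succ_of_hasDirDeriv (f' := fun u (q : (Fin k → Complexified E) × E) =>
      (π (e.symm u) : H →L[ℂ] H) (integral expG π f v
        (Complexified.ofReal (leftLogDeriv e u q.2) :: List.ofFn q.1))) e.open_target (hcont k)
      (fun u hu y h => ?_) ?_
    · have hline : Continuous (fun s : ℝ => u + s • h) := by fun_prop
      have hx : ContinuousAt (fun s : ℝ => leftLogDeriv e (u + s • h) h) 0 := by
        have h1 := (paramCk_leftLogDeriv hG he 0).continuousOn.continuousAt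
          ((e.open_target.prod isOpen_univ).mem_nhds (x := (u, h)) ⟨hu, trivial⟩)
        refine ContinuousAt.comp_of_eq (f := fun s : ℝ => (u + s • h, h)) h1
          (by fun_prop) (by simp)
      -- A chart line is in general not a one-parameter group, so its left velocity varies with s;
      -- only continuity at 0 is needed.
      have h2 := hv.hasDerivAt_integral hG hexp (c := fun s => e.symm (u + s • h)) hx ?_
        (List.ofFn y)
      · simp only [zero_smul, add_zero] at h2
        rw [hasDirDeriv_iff_line]
        exact hasDirDeriv_iff_hasDerivAt.2 h2
      · filter_upwards [eventually_line_mem e.open_target hu h] with s hs w hw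
        have h3 : Tendsto _ _ _ := hasDirDeriv_orbit_chart hG hw he hs h
        rw [hasDerivAt_iff_tendsto_slope_zero]
        refine h3.congr fun t => ?_
        rw [add_smul, add_assoc]
    · have hb := (ih (k + 1)).reindex (X' := (Fin k → Complexified E) × E)
        (r := fun q => Fin.cons (Complexified.ofReal q.2) q.1) (by
          refine continuous_pi fun i => Fin.cases ?_ (fun i => ?_) i
          · exact Complexified.continuous_ofReal.comp continuous_snd
          · exact (continuous_apply i).comp continuous_fst)
      have hlin := hb.linear_comp e.open_target (paramCk_leftLogDeriv hG he n) ?_ ?_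
      · simp only [List.ofFn_cons] at hlin
        exact hlin
      · intro u _ y z z'
        simp only [← hv.integralMultilinear_apply hG hexp, Complexified.ofReal_add,
          MultilinearMap.cons_add, map_add]
      · intro u _ y c z
        simp only [← hv.integralMultilinear_apply hG hexp, Complexified.ofReal_smul,
          MultilinearMap.cons_smul]
        exact ((π (e.symm u) : H →L[ℂ] H).restrictScalars ℝ).map_smul c _

theorem integral_mem (hG : IsLCLieGroup E G) (hexp : IsSmoothExp expG)
    (hπ : ∀ v : H, Continuous fun g => (π g : H →L[ℂ] H) v)
    (hv : DominatedFamily expG π f v) : integral expG π f v [] ∈ smoothSubmodule E π := by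
  intro e he n
  simpa using (hv.paramCk_integral hG hexp hπ he n 0).reindex
    (r := fun _ : PUnit.{u + 1} => Fin.elim0) continuous_const

end DominatedFamily

end Integral

/-! ### The invariance theorem. -/

theorem theorem2p3
    {E G H : Type*}
    -- `E` is the model space, a real locally convex Hausdorff space
    [AddCommGroup E] [Module ℝ E] [TopologicalSpace E] [IsTopologicalAddGroup E]
    [ContinuousSMul ℝ E] [LocallyConvexSpace ℝ E] [T2Space E]
    -- `G` is a locally convex Lie group with a smooth exponential map
    [TopologicalSpace G] [T2Space G] [ChartedSpace E G] [Group G]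
    (hG : IsLCLieGroup E G)
    (expG : E → G) (hexp : IsSmoothExp expG)
    -- `γ` is a one-parameter group of smooth automorphisms defining a continuous action
    (γ : Multiplicative ℝ →* MulAut G)
    (hγ : ∀ t : ℝ, SmoothMapLC E E (fun g : G => γ (Multiplicative.ofAdd t) g))
    (hγc : Continuous (fun p : ℝ × G => γ (Multiplicative.ofAdd p.1) p.2))
    -- `α_t = L(γ_t)_ℂ`
    (α : ℝ → Complexified E → Complexified E)
    (hα : ∀ t : ℝ, α t = Complexified.map
      (lieDifferential (fun g : G => γ (Multiplicative.ofAdd t) g)))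
    -- `π♯` is a continuous unitary representation of `G ⋊ ℝ` on the Hilbert space `H`
    [NormedAddCommGroup H] [InnerProductSpace ℂ H] [CompleteSpace H]
    (πs : G ⋊[γ] (Multiplicative ℝ) →* unitary (H →L[ℂ] H))
    (hπs : ∀ v : H, Continuous
      (fun p : G × ℝ => (πs ⟨p.1, Multiplicative.ofAdd p.2⟩ : H →L[ℂ] H) v))
    -- `π♯(g, t) = π(g) U_t`
    (π : G →* unitary (H →L[ℂ] H)) (hπ : π = πs.comp SemidirectProduct.inl)
    (U : ℝ → H →L[ℂ] H)
    (hU : ∀ t : ℝ, U t = (πs (SemidirectProduct.inr (Multiplicative.ofAdd t)) : H →L[ℂ] H))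
    (f : ℝ → ℂ)
    (hf : (EquicontFamily α ∧ Integrable f) ∨
      (PolyBounded α ∧ ∃ φ : 𝓢(ℝ, ℂ), ∀ t : ℝ, φ t = f t)) :
    (∀ v ∈ smoothVectors E π, integratedOp U f v ∈ smoothVectors E π) ∧
    (∀ v ∈ smoothVectors E π, ∀ ys : List (Complexified E),
      Integrable (fun t : ℝ => f t • U t (derivedRepList expG π (ys.map (α (-t))) v)) ∧
      derivedRepList expG π ys (integratedOp U f v) =
        ∫ t : ℝ, f t • U t (derivedRepList expG π (ys.map (α (-t))) v)) := by
  have hπv : ∀ g v, (π g : H →L[ℂ] H) v = (πs ⟨g, Multiplicative.ofAdd 0⟩ : H →L[ℂ] H) v := by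
    intro g v
    rw [hπ]
    rfl
  have hUv : ∀ t v, U t v = (πs ⟨1, Multiplicative.ofAdd t⟩ : H →L[ℂ] H) v := by
    intro t v
    rw [hU]
    rfl
  have hπc : ∀ v : H, Continuous fun g => (π g : H →L[ℂ] H) v := by
    intro v
    simp only [hπv]
    exact (hπs v).comp (f := fun g : G => (g, (0 : ℝ))) (by fun_prop)
  have hUc : ∀ v : H, Continuous fun t => U t v := by
    intro v
    simp only [hUv]
    exact (hπs v).comp (f := fun t : ℝ => ((1 : G), t)) (by fun_prop)
  have hUnorm : ∀ t v, ‖U t v‖ = ‖v‖ := by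
    intro t v
    rw [hU]
    exact ContinuousLinearMap.norm_map_of_mem_unitary (πs _).2 v
  -- The covariance relation, read off from (g, 0)(1, t) = (1, t)(γ_{-t}(g), 0) in the semidirect
  -- product.
  have hint : ∀ t g w, (π g : H →L[ℂ] H) (U t w) =
      U t ((π (γ (Multiplicative.ofAdd (-t)) g) : H →L[ℂ] H) w) := by
    intro t g w
    have hmul : (SemidirectProduct.inl g * SemidirectProduct.inr (Multiplicative.ofAdd t) :
        G ⋊[γ] (Multiplicative ℝ)) = SemidirectProduct.inr (Multiplicative.ofAdd t) *
          SemidirectProduct.inl (γ (Multiplicative.ofAdd (-t)) g) := by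
      ext
      · simp [ofAdd_neg]
      · simp
    rw [hU, hπ, MonoidHom.comp_apply, MonoidHom.comp_apply, ← unitaryRep_mul_apply πs,
      ← unitaryRep_mul_apply πs, hmul]
  have hγ1 : ∀ t : ℝ, γ (Multiplicative.ofAdd t) 1 = 1 := fun t => map_one _
  have hαs : ∀ t (c : ℝ) x, α t (c • x) = c • α t x := by
    intro t c x
    rw [hα]
    ext
    · simp only [Complexified.map, Complexified.re_real_smul, lieDifferential_smul (hγ t) (hγ1 t)]
    · simp only [Complexified.map, Complexified.im_real_smul, lieDifferential_smul (hγ t) (hγ1 t)]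
  have hfi : Integrable f := by
    rcases hf with ⟨-, hf⟩ | ⟨-, φ, hφ⟩
    · exact hf
    · exact φ.integrable.congr (Eventually.of_forall hφ)
  have hlist : ∀ v ∈ smoothSubmodule E π, ∀ (t : ℝ) (ys : List (Complexified E)),
      derivedRepList expG π ys (U t v) = U t (derivedRepList expG π (ys.map (α (-t))) v) := by
    intro v hv t ys
    rw [derivedRepList_intertwining hG hexp (hγ (-t)) (hγ1 (-t)) (hint t) hv, hα]
  have hdom : ∀ v ∈ smoothSubmodule E π, DominatedFamily expG π f (fun t => U t v) := by
    intro v hv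
    refine ⟨fun t => mem_smoothSubmodule_of_intertwining (hγ (-t)) (hint t) hv,
      (hUc v).stronglyMeasurable, hfi.aestronglyMeasurable, fun k => ?_⟩
    obtain ⟨C, p, hC, hp, hb⟩ := (derivedRepMultilinear hG hexp hv k).exists_seminorm_bound
      (smoothFamily_derivedRepList hG hexp hv k).continuous
    obtain ⟨m, q, hq, hm0, hmi, hmq⟩ := exists_weight_bound hαs hf hp
    -- The constant `C` comes from the multilinear bound for `v`, and each of the k arguments
    -- α_{-t}(y_i) contributes one factor m(t).
    refine ⟨fun t => C * m t ^ k, q, hq, fun t => mul_nonneg hC (pow_nonneg (hm0 t) k), ?_,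
      fun t y => ?_⟩
    · refine ((hmi k).const_mul C).congr (Eventually.of_forall fun t => ?_)
      ring
    · rw [hlist v hv, hUnorm, List.map_ofFn]
      refine (hb (fun i => α (-t) (y i))).trans ?_
      rw [mul_assoc]
      refine mul_le_mul_of_nonneg_left ?_ hC
      calc ∏ i, p (α (-t) (y i)) ≤ ∏ i, m t * q (y i) :=
            Finset.prod_le_prod (fun i _ => apply_nonneg p _) fun i _ => hmq t (y i)
        _ = m t ^ k * ∏ i, q (y i) := by
            rw [Finset.prod_mul_distrib, Finset.prod_const, Finset.card_univ, Fintype.card_fin]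
  refine ⟨fun v hv => ?_, fun v hv ys => ?_⟩
  · rw [mem_smoothVectors_iff hπc] at hv ⊢
    -- By definition `integratedOp U f v` is the integral for the empty list.
    exact (hdom v hv).integral_mem hG hexp hπc
  · rw [mem_smoothVectors_iff hπc] at hv
    simp only [← hlist v hv]
    exact ⟨(hdom v hv).integrable hG hexp ys, (hdom v hv).derivedRepList_integral hG hexp ys⟩
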